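/- **Notation.** A curve $f:\mathbb R\to\mathbb R^p$ is CPwL with at most $m$ breakpoints if it is continuous and there is a set of at most $m$ points such that $f$ is affine on every open interval that does not meet this set. For integers $W,D,N\ge 1$, let $\Upsilon_{W,D}(\mathrm{ReLU};1,N)$ be the set of maps $\mathbb R\to\mathbb R^N$ that are outputs of fully connected ReLU networks with $D$ hidden layers of $W$ neurons each and an affine output layer; the weights and biases are arbitrary real numbers. Let $M\ge 2$ and $p,r,L\ge 1$ be integers. Let $A_j^{ab}\in\mathbb R^{p\times p}$ ($1\le a,b\le r$, $j\in\mathbb Z$) be matrices that vanish for all but finitely many $j$, and let $B_a:\mathbb R\to\mathbb R^p$ ($1\le a\le r$). For a family $\Gamma=(\gamma_1,\dots,\gamma_r)$ of curves $\gamma_a:\mathbb R\to\mathbb R^p$, put $$(\mathfrak W\Gamma)_a(t)=\sum_{j\in\mathbb Z}\sum_{b=1}^r A_j^{ab}\,\gamma_b(Mt-j)+B_a(t),\qquad \operatorname{Stack}(\Gamma)(t)=\begin{pmatrix}\gamma_1(t)\\ \vdots\\ \gamma_r(t)\end{pmatrix}\in\mathbb R^{pr}.$$ Say that $\mathfrak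 W$ preserves the window $[0,L]$ if, for every family $\Gamma'=(\gamma'_1,\dots,\gamma'_r)$ of CPwL curves (each with finitely many breakpoints) supported in $[0,L]$, all the curves $(\mathfrak W\Gamma')_a$ are supported in $[0,L]$. **Corollary (Finite-state realizability).** Given $M,p,r,L$ and integers $m_\gamma,m_B\ge 0$, there are positive integers $C_0,C_1$, depending only on $M,p,r,L,m_\gamma,m_B$, with the following property. Let the matrices $A_j^{ab}$ and the curves $\gamma_a,B_a$ be as above, such that every $\gamma_a$ is CPwL with at most $m_\gamma$ breakpoints, every $B_a$ is CPwL with at most $m_B$ breakpoints, all $\gamma_a$ and $B_a$ are supported in $[0,L]$, and $\mathfrak W$ preserves the window $[0,L]$. Then $$\operatorname{Stack}(\mathfrak W^n\Gamma)\in\Upsilon_{C_0,C_1n^2}(\mathrm{ReLU};1,pr)\qquad\text{for all }n\ge 1.$$ With the same $C_0$ and $C_1$, for all $n\ge 1$, each state component $(\mathfrak W^n\Gamma)_a$ lies in $\Upsilon_{C_0,C_1n^2}(\mathrm{ReLU};1,p)$, and for every linear map $R:\mathbb R^{pr}\to\mathbb R^q$ the readout $R\circ\operatorname{Stack}(\mathfrak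 W^n\Gamma)$ lies in $\Upsilon_{C_0,C_1n^2}(\mathrm{ReLU};1,q)$. If all forcing terms vanish identically, $B_a\equiv 0$, then the three conclusions hold with linear depth, that is, with $C_1n$ in place of $C_1n^2$, for positive integers $C_0,C_1$ depending only on $M,p,r,L,m_\gamma$. -/

import Mathlib

open scoped Matrix

namespace ReLURefinement

/-- The componentwise rectifier `ReLU`. -/
def relu {W : ℕ} (x : Fin W → ℝ) : Fin W → ℝ := fun i => max (x i) 0

/-- `Upsilon W D d N` is the set of outputs of fully connected ReLU networks with input dimension
`d`, output dimension `N`, and `D` hidden layers of `W` neurons each: the maps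
`T_D ∘ relu ∘ T_{D-1} ∘ ⋯ ∘ relu ∘ T_0` with arbitrary affine maps `T_0 : ℝ^d → ℝ^W`,
`T_i : ℝ^W → ℝ^W` for `0 < i < D`, and `T_D : ℝ^W → ℝ^N`. The recursion peels off the first
hidden layer; for `D = 0` only the affine output map is left. -/
def Upsilon (W : ℕ) : (D d N : ℕ) → Set ((Fin d → ℝ) → (Fin N → ℝ))
  | 0, d, N =>
      {f | ∃ (T : Matrix (Fin N) (Fin d) ℝ) (c : Fin N → ℝ), ∀ x, f x = T *ᵥ x + c}
  | D + 1, d, N =>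
      {f | ∃ (T : Matrix (Fin W) (Fin d) ℝ) (c : Fin W → ℝ), ∃ g ∈ Upsilon W D W N,
        ∀ x, f x = g (relu (T *ᵥ x + c))}

/-- A curve `f : ℝ → ℝ^N`, seen as a map on `ℝ^1`, is an output of a ReLU network of width `W`
and depth `D`, i.e. `f ∈ Υ_{W,D}(ReLU; 1, N)`. -/
def CurveInUpsilon (W D N : ℕ) (f : ℝ → Fin N → ℝ) : Prop :=
  (fun x : Fin 1 → ℝ => f (x 0)) ∈ Upsilon W D 1 N

/-- `f : ℝ → ℝ^p` is continuous and piecewise linear with at most `m` breakpoints: it is continuous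
and there is a set `S` of at most `m` points such that `f` is affine on every open interval that
does not meet `S`. -/
def IsCPwLWith {p : ℕ} (m : ℕ) (f : ℝ → Fin p → ℝ) : Prop :=
  Continuous f ∧ ∃ S : Finset ℝ, S.card ≤ m ∧
    ∀ a b : ℝ, a < b → (∀ s ∈ S, s ∉ Set.Ioo a b) →
      ∃ u v : Fin p → ℝ, ∀ t ∈ Set.Ioo a b, f t = u + t • v

/-- The support of `f` is contained in the window `[0, L]`. -/
def SupportedIn {p : ℕ} (L : ℕ) (f : ℝ → Fin p → ℝ) : Prop :=
  tsupport f ⊆ Set.Icc (0 : ℝ) L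

/-- The finite-state affine refinement operator
`(𝔚 Γ)_a (t) = ∑_j ∑_b A_j^{ab} γ_b (M t - j) + B_a (t)`, where `A a b j` stands for `A_j^{ab}`.
The sum over `j` is meant for families `A` with finitely many nonzero matrices. -/
noncomputable def refineOp {p r : ℕ} (M : ℕ)
    (A : Fin r → Fin r → ℤ → Matrix (Fin p) (Fin p) ℝ) (B : Fin r → ℝ → Fin p → ℝ)
    (Γ : Fin r → ℝ → Fin p → ℝ) : Fin r → ℝ → Fin p → ℝ :=
  fun a t => (∑ᶠ j : ℤ, ∑ b : Fin r, A a b j *ᵥ Γ b ((M : ℝ) * t - (j : ℝ))) + B a t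

/-- The refinement operator preserves the window `[0, L]` statewise: families of CPwL state curves
supported in `[0, L]` are mapped to families supported in `[0, L]`. -/
def PreservesWindow {p r : ℕ} (M L : ℕ)
    (A : Fin r → Fin r → ℤ → Matrix (Fin p) (Fin p) ℝ) (B : Fin r → ℝ → Fin p → ℝ) : Prop :=
  ∀ Γ : Fin r → ℝ → Fin p → ℝ,
    (∀ a, (∃ m, IsCPwLWith m (Γ a)) ∧ SupportedIn L (Γ a)) →
      ∀ a, SupportedIn L (refineOp M A B Γ a)

/-- The stacked curve in `ℝ^{pr}`: the blocks `γ_1 (t), …, γ_r (t)` of length `p` are written one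
below the other (entry `i` of block `a` sits at position `i + p * a`). -/
def stack {p r : ℕ} (Γ : Fin r → ℝ → Fin p → ℝ) : ℝ → Fin (r * p) → ℝ :=
  fun t k => Γ (finProdFinEquiv.symm k).1 t (finProdFinEquiv.symm k).2

/-- The family `Γ`, all its components, and all linear readouts of its stacked curve are outputs
of ReLU networks of width `W` and depth `D`. -/
def Realized {p r : ℕ} (W D : ℕ) (Γ : Fin r → ℝ → Fin p → ℝ) : Prop :=
  CurveInUpsilon W D (r * p) (stack Γ) ∧
  (∀ a, CurveInUpsilon W D p (Γ a)) ∧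
  ∀ (q : ℕ) (R : (Fin (r * p) → ℝ) →ₗ[ℝ] (Fin q → ℝ)),
    CurveInUpsilon W D q (fun t => R (stack Γ t))

end ReLURefinement

/-!
The operator is affine, so the `n`-th iterate is `V^n Γ + ∑_{k < n} V^k B` with `V` the linear part of
the refinement operator. It therefore suffices to compute the iterates `V^n g` of continuous
piecewise linear curves by networks of fixed width and depth `O(n)`
(`realizable_refineLin_pow`); the sum over `k` is computed term by term in fixed width and depth
`O(n²)` (`Net.sum_range`). Testing the window condition with hat functions shows that only the shifts
`0 ≤ j ≤ (M - 1) L` occur (`PreservesWindow.apply_eq_zero`), so `V` preserves the window as well.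

For linear depth, `g` is written as a bounded number of translates of bumps `h` supported in
`[3/8, 5/8]` (`sum_bump`); translations are harmless since `V^n` turns a shift by `s` into a shift by
`s / M^n` (`refineLin_pow_shift`). On each interval of length `M⁻ⁿ` the function `V^n (h e)` at `t` is
`h (fract (M^n t))` times a coefficient that depends linearly, digit by digit, on the base-`M` digits
of `⌊M^n t⌋`, the leading digit coming first (`refineLin_pow_eq_digitVec`).

A network cannot read digits exactly near the discontinuities, but there the bump vanishes. The
network (`realizable_digitVec`) first computes the amplitude `h (fract (M^n t))` with approximate
digits and sets it to zero wherever the digits are unreliable, which the distance of `M^n t` to the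
integers tells; this distance is a continuous function and an exact iterate of zigzag maps
(`iterate_zigzag`). It then reads the digits a second time and applies the linear digit maps to a
state vector scaled by the amplitude. Multiplication by digit indicators is done by gates, which are
exact for indicators with values in `{0, 1}` and map zero to zero. So the state stays zero where the
amplitude vanishes, whatever the misread digits are, and is correct everywhere else. The amplitude is
available before the digit pass, which is why no bilinear product is needed at the end.

All weights may depend on `n` and on the data, but the architecture may not: this uniformity is
tracked by `Realizable`.
-/

namespace ReLURefinement

/-! ### ReLU networks between real vector spaces -/

/-- `Net W D E f`: the map `f : E → F` between real vector spaces is the output of a ReLU network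
with `D` hidden layers of width `W`. This is `Upsilon` with linear maps instead of matrices, so that
products and function spaces can be used as input and output spaces. -/
def Net (W : ℕ) {F : Type} [AddCommGroup F] [Module ℝ F] :
    ℕ → (E : Type) → [AddCommGroup E] → [Module ℝ E] → (E → F) → Prop
  | 0, E, _, _, f => ∃ (T : E →ₗ[ℝ] F) (c : F), ∀ x, f x = T x + c
  | D + 1, E, _, _, f => ∃ (T : E →ₗ[ℝ] (Fin W → ℝ)) (c : Fin W → ℝ) (g : (Fin W → ℝ) → F),
      Net W D (Fin W → ℝ) g ∧ ∀ x, f x = g (relu (T x + c))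

section Net

variable {E E' F F' G : Type} [AddCommGroup E] [Module ℝ E] [AddCommGroup E'] [Module ℝ E']
  [AddCommGroup F] [Module ℝ F] [AddCommGroup F'] [Module ℝ F'] [AddCommGroup G] [Module ℝ G]
  {W W' D D' : ℕ}

theorem Net.upsilon {N : ℕ} : ∀ {D d : ℕ} {f : (Fin d → ℝ) → Fin N → ℝ},
    Net W D (Fin d → ℝ) f → f ∈ Upsilon W D d N
  | 0, _, f, ⟨T, c, h⟩ => ⟨LinearMap.toMatrix' T, c, fun x => by
      rw [h, LinearMap.toMatrix'_mulVec]⟩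
  | _ + 1, _, f, ⟨T, c, g, hg, h⟩ => ⟨LinearMap.toMatrix' T, c, g, Net.upsilon hg, fun x => by
      rw [h, LinearMap.toMatrix'_mulVec]⟩

theorem Net.postcomp : ∀ {D : ℕ} {E : Type} [AddCommGroup E] [Module ℝ E] {f : E → F},
    Net W D E f → ∀ (T : F →ₗ[ℝ] G) (c : G), Net W D E (fun x => T (f x) + c)
  | 0, _, _, _, f, ⟨S, b, h⟩, T, c => ⟨T ∘ₗ S, T b + c, fun x => by simp [h, add_assoc]⟩
  | _ + 1, _, _, _, f, ⟨S, b, g, hg, h⟩, T, c => ⟨S, b, _, hg.postcomp T c, fun x => by simp only [h]⟩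

theorem Net.precomp {f : E → F} (hf : Net W D E f) (T : E' →ₗ[ℝ] E) (c : E) :
    Net W D E' (fun x => f (T x + c)) := by
  cases D with
  | zero =>
    obtain ⟨S, b, h⟩ := hf
    exact ⟨S ∘ₗ T, S c + b, fun x => by simp [h, add_assoc]⟩
  | succ D =>
    obtain ⟨S, b, g, hg, h⟩ := hf
    exact ⟨S ∘ₗ T, S c + b, g, hg, fun x => by simp [h, add_assoc]⟩

theorem Net.comp {g : F → G} (hg : Net W D' F g) : ∀ {D : ℕ} {E : Type} [AddCommGroup E]
    [Module ℝ E] {f : E → F}, Net W D E f → Net W (D + D') E (fun x => g (f x))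
  | 0, _, _, _, f, ⟨S, b, h⟩ => by
      rw [zero_add]
      simpa only [h] using hg.precomp S b
  | D + 1, _, _, _, f, ⟨S, b, f', hf', h⟩ => by
      rw [Nat.add_right_comm]
      exact ⟨S, b, _, hg.comp hf', fun x => by simp only [h]⟩

theorem Net.mono (hW : W ≤ W') : ∀ {D : ℕ} {E : Type} [AddCommGroup E] [Module ℝ E] {f : E → F},
    Net W D E f → Net W' D E f
  | 0, _, _, _, f, h => h
  | D + 1, _, _, _, f, ⟨S, b, g, hg, h⟩ => by
      let ext : (Fin W → ℝ) →ₗ[ℝ] (Fin W' → ℝ) :=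
        { toFun := fun v i => if hi : i.1 < W then v ⟨i.1, hi⟩ else 0
          map_add' := fun v w => by ext i; by_cases hi : i.1 < W <;> simp [hi]
          map_smul' := fun v w => by ext i; by_cases hi : i.1 < W <;> simp [hi] }
      refine ⟨ext ∘ₗ S, ext b, _,
        (hg.mono hW).precomp (LinearMap.funLeft ℝ ℝ (Fin.castLE hW)) 0, fun x => ?_⟩
      rw [h]
      congr 1
      ext i
      simp [ext, relu, LinearMap.funLeft]

/-- Two networks run in parallel on separate inputs. -/
theorem Net.prodMap : ∀ {D : ℕ} {E E' : Type} [AddCommGroup E] [Module ℝ E] [AddCommGroup E']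
    [Module ℝ E'] {f : E → F} {f' : E' → F'}, Net W D E f → Net W' D E' f' →
    Net (W + W') D (E × E') (fun x => (f x.1, f' x.2))
  | 0, _, _, _, _, _, _, f, f', ⟨S, b, h⟩, ⟨S', b', h'⟩ =>
      ⟨S.prodMap S', (b, b'), fun x => by simp [h, h']⟩
  | D + 1, _, _, _, _, _, _, f, f', ⟨S, b, g, hg, h⟩, ⟨S', b', g', hg', h'⟩ => by
      let join : ((Fin W → ℝ) × (Fin W' → ℝ)) →ₗ[ℝ] (Fin (W + W') → ℝ) :=
        { toFun := fun v => Fin.append v.1 v.2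
          map_add' := fun v w => by ext i; refine Fin.addCases ?_ ?_ i <;> simp
          map_smul' := fun v w => by ext i; refine Fin.addCases ?_ ?_ i <;> simp }
      refine ⟨join ∘ₗ S.prodMap S', join (b, b'), _, (hg.prodMap hg').precomp
        ((LinearMap.funLeft ℝ ℝ (Fin.castAdd W')).prod (LinearMap.funLeft ℝ ℝ (Fin.natAdd W))) 0,
        fun x => ?_⟩
      simp only [h, h']
      congr 2 <;> ext i <;> simp [join, relu, LinearMap.funLeft]

/-- Two networks run in parallel on the same input. -/
theorem Net.prodMk {f : E → F} {f' : E → F'} (hf : Net W D E f) (hf' : Net W' D E f') :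
    Net (W + W') D E (fun x => (f x, f' x)) := by
  simpa using (hf.prodMap hf').precomp (LinearMap.id.prod LinearMap.id) 0

theorem Net.add {f f' : E → F} (hf : Net W D E f) (hf' : Net W' D E f') :
    Net (W + W') D E (fun x => f x + f' x) := by
  simpa using (hf.prodMk hf').postcomp (LinearMap.id.coprod LinearMap.id) 0

theorem Net.const (c : F) : ∀ {D : ℕ} {E : Type} [AddCommGroup E] [Module ℝ E],
    Net W D E (fun _ => c)
  | 0, _, _, _ => ⟨0, c, fun x => by simp⟩
  | _ + 1, _, _, _ => ⟨0, 0, _, Net.const c, fun _ => rfl⟩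

theorem Net.sum {κ : Type*} (s : Finset κ) {f : κ → E → F} (hf : ∀ i ∈ s, Net W D E (f i)) :
    Net (s.card * W) D E (fun x => ∑ i ∈ s, f i x) := by
  classical
  induction s using Finset.induction_on with
  | empty => simpa using Net.const (0 : F)
  | insert a s ha ih =>
    simp only [Finset.sum_insert ha, Finset.card_insert_of_notMem ha]
    rw [add_mul, one_mul, add_comm]
    exact (hf a (Finset.mem_insert_self a s)).add
      (ih fun i hi => hf i (Finset.mem_insert_of_mem hi))

/-- Networks with the same input run in parallel, with one output coordinate each. -/
theorem Net.pi {ι : Type} [Fintype ι] {f : E → ι → ℝ} (hf : ∀ i, Net W D E (fun x => f x i)) :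
    Net (Fintype.card ι * W) D E f := by
  classical
  have := Net.sum (Finset.univ : Finset ι) (W := W) (D := D)
    (f := fun i x => (Pi.single i (f x i) : ι → ℝ))
    (fun i _ => by simpa using (hf i).postcomp (LinearMap.single ℝ (fun _ : ι => ℝ) i) 0)
  simp only [Finset.univ_sum_single] at this
  exact this

theorem Net.relu : Net 1 1 ℝ (fun x => max x 0) :=
  ⟨LinearMap.pi fun _ => LinearMap.id, 0, fun v => v 0, ⟨LinearMap.proj 0, 0, fun x => by simp⟩,
    fun x => by simp [ReLURefinement.relu]⟩

/-- The identity of the line is a network of every depth, since `x = max x 0 - max (-x) 0`. -/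
theorem Net.id_real (D : ℕ) : Net 2 D ℝ (fun x => x) := by
  induction D with
  | zero => exact ⟨LinearMap.id, 0, fun x => by simp⟩
  | succ D ih =>
    have h := (Net.relu.precomp LinearMap.id 0).add
      ((Net.relu.precomp (-LinearMap.id) 0).postcomp (-LinearMap.id) (0 : ℝ))
    have h' : Net 2 1 ℝ (fun x => x) := by
      convert h using 2 with x
      rcases le_total x 0 with hx | hx <;> simp [hx]
    exact h'.comp ih

theorem Net.id_pi (ι : Type) [Fintype ι] (D : ℕ) :
    Net (Fintype.card ι * 2) D (ι → ℝ) (fun x => x) :=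
  Net.pi fun i => by simpa using (Net.id_real D).precomp (LinearMap.proj (φ := fun _ : ι => ℝ) i) 0

theorem Net.id_finite (F : Type) [AddCommGroup F] [Module ℝ F] [FiniteDimensional ℝ F] (D : ℕ) :
    Net (Module.finrank ℝ F * 2) D F (fun x => x) := by
  let b := (Module.finBasis ℝ F).equivFun
  have := ((Net.id_pi (Fin (Module.finrank ℝ F)) D).precomp b.toLinearMap 0).postcomp
    b.symm.toLinearMap 0
  simpa using this

/-- Extra hidden layers can be inserted at the output once the width is at least twice the output
dimension. -/
theorem Net.mono_depth [FiniteDimensional ℝ F] {f : E → F} (hf : Net W D E f)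
    (hW : Module.finrank ℝ F * 2 ≤ W) (hD : D ≤ D') : Net W D' E f := by
  obtain ⟨k, rfl⟩ := Nat.exists_eq_add_of_le hD
  exact ((Net.id_finite F k).mono hW).comp hf

theorem Net.iterate {f : E → E} (hf : Net W D E f) (n : ℕ) : Net W (D * n) E (f^[n]) := by
  induction n with
  | zero => exact ⟨LinearMap.id, 0, fun x => by simp⟩
  | succ n ih =>
    rw [mul_add, mul_one, add_comm]
    exact ih.comp hf

/-- A long sum of networks with the same input: the terms are computed one after the other, so the
width does not depend on the number of terms. -/
theorem Net.sum_range [FiniteDimensional ℝ E] [FiniteDimensional ℝ F] {f : ℕ → E → F} (n : ℕ)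
    (hf : ∀ k < n, Net W D E (f k)) :
    Net (W + Module.finrank ℝ (E × F) * 2) (D * n) E (fun x => ∑ k ∈ Finset.range n, f k x) := by
  have key : Net (W + Module.finrank ℝ (E × F) * 2) (D * n) (E × F)
      (fun z => (z.1, z.2 + ∑ k ∈ Finset.range n, f k z.1)) := by
    induction n with
    | zero => exact ⟨LinearMap.id, 0, fun x => by simp⟩
    | succ n ih =>
      have h1 := (((hf n n.lt_succ_self).precomp (LinearMap.fst ℝ E F) 0).postcomp
        (LinearMap.inr ℝ E F) 0).add (Net.id_finite (E × F) D)
      have h2 := h1.comp (ih fun k hk => hf k (hk.trans n.lt_succ_self))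
      rw [mul_add, mul_one]
      convert h2 using 2 with z
      ext <;> simp [Finset.sum_range_succ]
      abel
  have := (key.precomp (LinearMap.inl ℝ E F) 0).postcomp (LinearMap.snd ℝ E F) 0
  simpa using this

end Net

/-! ### Uniformly realizable families -/

/-- The family `f p`, `p : P`, consists of networks of one common width `W` and of depths `C * δ p`
with a common factor `C`; only the weights may depend on `p` in any other way. -/
def Realizable {P : Type*} (δ : P → ℕ) {E F : Type} [AddCommGroup E] [Module ℝ E]
    [AddCommGroup F] [Module ℝ F] (f : P → E → F) : Prop :=
  ∃ W C : ℕ, ∀ p, Net W (C * δ p) E (f p)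

section Realizable

variable {P : Type*} {δ : P → ℕ}
  {E F G : Type} [AddCommGroup E] [Module ℝ E] [AddCommGroup F] [Module ℝ F]
  [AddCommGroup G] [Module ℝ G]

theorem Realizable.affine (T : P → E →ₗ[ℝ] F) (c : P → F) :
    Realizable δ (fun p x => T p x + c p) :=
  ⟨0, 0, fun p => by rw [zero_mul]; exact ⟨T p, c p, fun _ => rfl⟩⟩

theorem Realizable.linear (T : P → E →ₗ[ℝ] F) : Realizable δ (fun p x => T p x) := by
  simpa using Realizable.affine T 0

theorem Realizable.const (c : P → F) : Realizable δ (fun p (_ : E) => c p) := by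
  simpa using Realizable.affine 0 c

theorem Realizable.id : Realizable δ (fun (_ : P) (x : E) => x) :=
  Realizable.linear fun _ => LinearMap.id

theorem Realizable.comp {g : P → F → G} {f : P → E → F} (hg : Realizable δ g)
    (hf : Realizable δ f) : Realizable δ (fun p x => g p (f p x)) := by
  obtain ⟨W, C, h⟩ := hg
  obtain ⟨W', C', h'⟩ := hf
  refine ⟨max W W', C' + C, fun p => ?_⟩
  rw [add_mul]
  exact ((h p).mono (le_max_left _ _)).comp ((h' p).mono (le_max_right _ _))

theorem Realizable.prodMk [FiniteDimensional ℝ F] [FiniteDimensional ℝ G] {f : P → E → F}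
    {g : P → E → G} (hf : Realizable δ f) (hg : Realizable δ g) :
    Realizable δ (fun p x => (f p x, g p x)) := by
  obtain ⟨W, C, h⟩ := hf
  obtain ⟨W', C', h'⟩ := hg
  refine ⟨max W (Module.finrank ℝ F * 2) + max W' (Module.finrank ℝ G * 2), max C C', fun p => ?_⟩
  exact (((h p).mono (le_max_left _ _)).mono_depth (le_max_right _ _)
      (Nat.mul_le_mul_right _ (le_max_left _ _))).prodMk
    (((h' p).mono (le_max_left _ _)).mono_depth (le_max_right _ _)
      (Nat.mul_le_mul_right _ (le_max_right _ _)))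

theorem Realizable.mono [FiniteDimensional ℝ F] {δ' : P → ℕ} (hδ : ∀ p, δ p ≤ δ' p)
    {f : P → E → F} (hf : Realizable δ f) : Realizable δ' f := by
  obtain ⟨W, C, h⟩ := hf
  exact ⟨max W (Module.finrank ℝ F * 2), C, fun p => ((h p).mono (le_max_left _ _)).mono_depth
    (le_max_right _ _) (Nat.mul_le_mul_left _ (hδ p))⟩

theorem Realizable.add [FiniteDimensional ℝ F] {f g : P → E → F} (hf : Realizable δ f)
    (hg : Realizable δ g) : Realizable δ (fun p x => f p x + g p x) := by
  simpa using (Realizable.linear fun _ => LinearMap.id.coprod LinearMap.id).comp (hf.prodMk hg)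

theorem Realizable.sum [FiniteDimensional ℝ F] {κ : Type*} (s : Finset κ) {f : κ → P → E → F}
    (hf : ∀ i ∈ s, Realizable δ (f i)) : Realizable δ (fun p x => ∑ i ∈ s, f i p x) := by
  classical
  induction s using Finset.induction_on with
  | empty => simpa using Realizable.const (0 : P → F)
  | insert a s ha ih =>
    simp only [Finset.sum_insert ha]
    exact (hf a (Finset.mem_insert_self a s)).add
      (ih fun i hi => hf i (Finset.mem_insert_of_mem hi))

theorem Realizable.pi {ι : Type} [Fintype ι] {f : P → E → ι → ℝ}
    (hf : ∀ i, Realizable δ (fun p x => f p x i)) : Realizable δ f := by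
  classical
  have := Realizable.sum (δ := δ) (Finset.univ : Finset ι)
    (f := fun i p x => (Pi.single i (f p x i) : ι → ℝ))
    (fun i _ => (Realizable.linear (F := ι → ℝ)
      fun _ => LinearMap.single ℝ (fun _ : ι => ℝ) i).comp (hf i))
  simpa only [Finset.univ_sum_single] using this

theorem Realizable.smul_vec (c : P → F) {f : P → E → ℝ} (hf : Realizable δ f) :
    Realizable δ (fun p x => f p x • c p) := by
  simpa using (Realizable.linear fun p => LinearMap.toSpanSingleton ℝ F (c p)).comp hf

theorem Realizable.const_mul (c : P → ℝ) {f : P → E → ℝ} (hf : Realizable δ f) :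
    Realizable δ (fun p x => c p * f p x) := by
  simpa [mul_comm] using hf.smul_vec c

theorem Realizable.sub {f g : P → E → ℝ} (hf : Realizable δ f) (hg : Realizable δ g) :
    Realizable δ (fun p x => f p x - g p x) := by
  simpa [sub_eq_add_neg] using hf.add (hg.const_mul fun _ => -1)

theorem Realizable.max_zero (hδ : ∀ p, 1 ≤ δ p) {f : P → E → ℝ} (hf : Realizable δ f) :
    Realizable δ (fun p x => max (f p x) 0) := by
  have h : Realizable (fun _ : P => 1) (fun _ x => max x (0 : ℝ)) := ⟨1, 1, fun _ => Net.relu⟩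
  exact (h.mono hδ).comp hf

theorem Realizable.max (hδ : ∀ p, 1 ≤ δ p) {f g : P → E → ℝ} (hf : Realizable δ f)
    (hg : Realizable δ g) : Realizable δ (fun p x => max (f p x) (g p x)) := by
  convert ((hf.sub hg).max_zero hδ).add hg using 3 with p x
  rw [← max_add_add_right, sub_add_cancel, zero_add]

theorem Realizable.min (hδ : ∀ p, 1 ≤ δ p) {f g : P → E → ℝ} (hf : Realizable δ f)
    (hg : Realizable δ g) : Realizable δ (fun p x => min (f p x) (g p x)) := by
  convert ((hf.const_mul fun _ => -1).max hδ (hg.const_mul fun _ => -1)).const_mul fun _ => -1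
    using 3 with p x
  simp only [neg_mul, one_mul, max_neg_neg, neg_neg]

theorem Realizable.iterate (n : P → ℕ) {f : P → E → E} (hf : Realizable (fun _ => 1) f) :
    Realizable n (fun p => (f p)^[n p]) := by
  obtain ⟨W, C, h⟩ := hf
  exact ⟨W, C, fun p => by simpa using (h p).iterate (n p)⟩

end Realizable

/-! ### Digit extraction and gates -/

/-- The continuous function of `u` that is `0` for `u ≤ i - ε`, `1` for `u ≥ i`, and affine in
between. -/
noncomputable def ramp (ε u i : ℝ) : ℝ := min 1 (max ((u - i) * ε⁻¹ + 1) 0)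

/-- A continuous substitute for the indicator function of `⌊u⌋₊ = d`, exact as long as the
fractional part of `u` is at most `1 - ε`. -/
noncomputable def digitSel (ε u : ℝ) (d : ℕ) : ℝ := ramp ε u d - ramp ε u (d + 1)

/-- A continuous substitute for the fractional part of `u ∈ [0, N)`, exact as long as the fractional
part is at most `1 - ε`. -/
noncomputable def softFract (ε : ℝ) (N : ℕ) (u : ℝ) : ℝ :=
  u - ∑ d ∈ Finset.range N, (d : ℝ) * digitSel ε u d

/-- The distance of `u` to the integers, for `u ∈ [0, N]`, continued by zero. -/
noncomputable def zigzag (N : ℕ) (u : ℝ) : ℝ :=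
  ∑ d ∈ Finset.range N, max (min (u - d) (1 - (u - d))) 0

/-- A substitute for the product `v * c` that is exact for `c ∈ {0, 1}` and `|v| ≤ K`. -/
noncomputable def gate (K v c : ℝ) : ℝ := max (v - K * (1 - c)) 0 - max (-v - K * (1 - c)) 0

/-- The distance of `u` to the integers. -/
noncomputable def intDist (u : ℝ) : ℝ := min (Int.fract u) (1 - Int.fract u)

theorem ramp_natCast {ε u : ℝ} (hε : 0 < ε) (hu : 0 ≤ u) (hf : Int.fract u ≤ 1 - ε) (i : ℕ) :
    ramp ε u i = if i ≤ ⌊u⌋₊ then 1 else 0 := by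
  unfold ramp
  split_ifs with h
  · have h1 : (i : ℝ) ≤ u := (Nat.le_floor_iff hu).1 h
    have : 0 ≤ (u - i) * ε⁻¹ := mul_nonneg (sub_nonneg.2 h1) (inv_nonneg.2 hε.le)
    rw [min_eq_left]
    exact le_max_of_le_left (by linarith)
  · have h1 : ((⌊u⌋₊ : ℕ) : ℝ) + 1 ≤ i := by exact_mod_cast not_le.1 h
    have h2 : u = ⌊u⌋₊ + Int.fract u := by
      rw [natCast_floor_eq_intCast_floor hu]; exact (Int.floor_add_fract u).symm
    have h3 : (u - i) * ε⁻¹ ≤ -1 := by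
      rw [← div_eq_mul_inv, div_le_iff₀ hε]; linarith
    rw [max_eq_right (by linarith), min_eq_right zero_le_one]

theorem digitSel_eq {ε u : ℝ} (hε : 0 < ε) (hu : 0 ≤ u) (hf : Int.fract u ≤ 1 - ε) (d : ℕ) :
    digitSel ε u d = if ⌊u⌋₊ = d then 1 else 0 := by
  have h := ramp_natCast hε hu hf (d + 1)
  push_cast at h
  rw [digitSel, h, ramp_natCast hε hu hf d]
  split_ifs <;> first | omega | norm_num

theorem softFract_eq {ε u : ℝ} {N : ℕ} (hε : 0 < ε) (hu : 0 ≤ u) (huN : u < N)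
    (hf : Int.fract u ≤ 1 - ε) : softFract ε N u = Int.fract u := by
  have h : ⌊u⌋₊ < N := (Nat.floor_lt hu).2 huN
  simp only [softFract, digitSel_eq hε hu hf, mul_ite, mul_one, mul_zero, Finset.sum_ite_eq,
    Finset.mem_range, h, if_true]
  rw [Int.fract, natCast_floor_eq_intCast_floor hu]

theorem gate_zero (K c : ℝ) : gate K 0 c = 0 := by
  simp [gate]

theorem gate_ite {K v : ℝ} (hv : |v| ≤ K) (Q : Prop) [Decidable Q] :
    gate K v (if Q then 1 else 0) = if Q then v else 0 := by
  have := abs_le.1 hv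
  unfold gate
  split_ifs
  · rcases le_total v 0 with h | h <;> simp [h]
  · rw [max_eq_right (by linarith), max_eq_right (by linarith), sub_zero]

theorem zigzag_of_nonpos {u : ℝ} (N : ℕ) (hu : u ≤ 0) : zigzag N u = 0 :=
  Finset.sum_eq_zero fun d _ => max_eq_right <| min_le_of_left_le <| by
    have : (0 : ℝ) ≤ d := d.cast_nonneg
    linarith

theorem zigzag_of_ge {u : ℝ} {N : ℕ} (hu : (N : ℝ) ≤ u) : zigzag N u = 0 :=
  Finset.sum_eq_zero fun d hd => max_eq_right <| min_le_of_right_le <| by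
    have : (d : ℝ) + 1 ≤ N := by exact_mod_cast Finset.mem_range.1 hd
    linarith

theorem zigzag_eq {u : ℝ} {N : ℕ} (hu : 0 ≤ u) (huN : u < N) : zigzag N u = intDist u := by
  have h2 : u = ⌊u⌋₊ + Int.fract u := by
    rw [natCast_floor_eq_intCast_floor hu]; exact (Int.floor_add_fract u).symm
  have h0 := Int.fract_nonneg u
  have h1 := Int.fract_lt_one u
  unfold zigzag
  rw [Finset.sum_eq_single ⌊u⌋₊]
  · rw [show u - ⌊u⌋₊ = Int.fract u by linarith]
    exact max_eq_left (le_min h0 (by linarith))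
  · intro d _ hd
    refine max_eq_right ?_
    rcases lt_or_gt_of_ne hd with h | h
    · have : (d : ℝ) + 1 ≤ ⌊u⌋₊ := by exact_mod_cast h
      exact min_le_of_right_le (by linarith)
    · have : (⌊u⌋₊ : ℝ) + 1 ≤ d := by exact_mod_cast h
      exact min_le_of_left_le (by linarith)
  · intro h
    exact absurd (Finset.mem_range.2 ((Nat.floor_lt hu).2 huN)) h

theorem intDist_nonneg (u : ℝ) : 0 ≤ intDist u :=
  le_min (Int.fract_nonneg u) (by linarith [Int.fract_lt_one u])

theorem intDist_le_half (u : ℝ) : intDist u ≤ 1 / 2 := by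
  unfold intDist
  rcases le_total (Int.fract u) (1 / 2) with h | h
  · exact min_le_of_left_le h
  · exact min_le_of_right_le (by linarith)

theorem intDist_neg (u : ℝ) : intDist (-u) = intDist u := by
  unfold intDist
  by_cases h : Int.fract u = 0
  · rw [h, Int.fract_neg_eq_zero.2 h]
  · rw [Int.fract_neg h, min_comm, sub_sub_cancel]

theorem intDist_sub_int (u : ℝ) (k : ℤ) : intDist (u - k) = intDist u := by
  simp [intDist]

theorem intDist_natCast_mul (M : ℕ) (u : ℝ) : intDist (M * intDist u) = intDist (M * u) := by
  have hf : Int.fract u = u - ⌊u⌋ := rfl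
  rcases min_choice (Int.fract u) (1 - Int.fract u) with h | h
  · rw [intDist.eq_1 u, h, hf, mul_sub]
    exact_mod_cast intDist_sub_int (M * u) (M * ⌊u⌋)
  · rw [intDist.eq_1 u, h, hf, ← intDist_neg]
    convert intDist_sub_int (M * u) (M * ⌊u⌋ + M) using 2
    push_cast
    ring

/-- The zigzag maps compute the distance of `M ^ n * t` to the integers exactly, with no digit of `t`
involved. -/
theorem iterate_zigzag {M L : ℕ} (hM : 1 ≤ M) (n : ℕ) (t : ℝ) :
    (fun s : ℝ => zigzag M (M * s))^[n] (zigzag L t) =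
      if 0 ≤ t ∧ t < L then intDist ((M : ℝ) ^ n * t) else 0 := by
  have hM' : (1 : ℝ) ≤ M := by exact_mod_cast hM
  induction n with
  | zero =>
    split_ifs with h
    · simpa using zigzag_eq h.1 h.2
    · rcases not_and_or.1 h with h | h
      · exact zigzag_of_nonpos L (not_le.1 h).le
      · exact zigzag_of_ge (not_lt.1 h)
  | succ n ih =>
    rw [Function.iterate_succ_apply', ih]
    split_ifs
    · have h1 := intDist_nonneg ((M : ℝ) ^ n * t)
      have h2 := intDist_le_half ((M : ℝ) ^ n * t)
      rw [zigzag_eq (by positivity) (by nlinarith), intDist_natCast_mul, pow_succ']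
      ring_nf
    · simpa using zigzag_of_nonpos M le_rfl

/-- If `M ^ n * t` is not just below an integer, then neither is any `M ^ k * t` with `k ≤ n`. -/
theorem fract_pow_mul_le {M : ℕ} (hM : 1 ≤ M) {n k : ℕ} (hk : k ≤ n) {t : ℝ}
    (h : Int.fract ((M : ℝ) ^ n * t) ≤ 3 / 4) :
    Int.fract ((M : ℝ) ^ k * t) ≤ 1 - (4 * (M : ℝ) ^ n)⁻¹ := by
  have hM' : (1 : ℝ) ≤ M := by exact_mod_cast hM
  obtain ⟨m, rfl⟩ := Nat.exists_eq_add_of_le hk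
  set x := (M : ℝ) ^ k * t
  have hx : (M : ℝ) ^ (k + m) * t = (M : ℝ) ^ m * x := by rw [pow_add]; ring
  rw [hx] at h
  have hm : (1 : ℝ) ≤ (M : ℝ) ^ m := one_le_pow₀ hM'
  have hmn : (4 * (M : ℝ) ^ (k + m))⁻¹ ≤ (4 * (M : ℝ) ^ m)⁻¹ := by
    gcongr
    omega
  by_contra! hlt
  have hlt : 1 - (4 * (M : ℝ) ^ m)⁻¹ < Int.fract x := by linarith
  have h1 : (M : ℝ) ^ m * (4 * (M : ℝ) ^ m)⁻¹ = 1 / 4 := by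
    field_simp
  have h2 : (M : ℝ) ^ m - 1 / 4 < (M : ℝ) ^ m * Int.fract x := by
    have := mul_lt_mul_of_pos_left hlt (by positivity : (0 : ℝ) < (M : ℝ) ^ m)
    linarith
  have h3 : (M : ℝ) ^ m * Int.fract x < (M : ℝ) ^ m := by
    have := mul_lt_mul_of_pos_left (Int.fract_lt_one x) (by positivity : (0 : ℝ) < (M : ℝ) ^ m)
    linarith
  have h4 : Int.fract ((M : ℝ) ^ m * x) = (M : ℝ) ^ m * Int.fract x - ((M : ℝ) ^ m - 1) := by
    rw [Int.fract_eq_iff]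
    refine ⟨by linarith, by linarith, (M : ℤ) ^ m * ⌊x⌋ + (M : ℤ) ^ m - 1, ?_⟩
    push_cast
    rw [Int.fract]
    ring
  linarith

theorem fract_natCast_mul_fract (M : ℕ) (z : ℝ) : Int.fract (M * Int.fract z) = Int.fract (M * z) := by
  rw [Int.fract.eq_1 z, mul_sub]
  exact_mod_cast Int.fract_sub_intCast (M * z) (M * ⌊z⌋)

theorem natFloor_mul_fract {M : ℕ} (hM : 1 ≤ M) {z : ℝ} (hz : 0 ≤ z) :
    ⌊(M : ℝ) * Int.fract z⌋₊ = ⌊(M : ℝ) * z⌋₊ % M := by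
  have h1 : ⌊(M : ℝ) * z⌋₊ / M = ⌊z⌋₊ := by
    rw [← Nat.floor_div_natCast, mul_div_cancel_left₀]
    exact_mod_cast (by omega : M ≠ 0)
  have h2 : (M : ℝ) * Int.fract z = M * z - ((M * ⌊z⌋₊ : ℕ) : ℝ) := by
    rw [Int.fract, Nat.cast_mul, natCast_floor_eq_intCast_floor hz]; ring
  rw [h2, Nat.floor_sub_natCast, Nat.mod_eq_sub_mul_div, h1]

/-! ### Networks for digit-driven linear recursions -/

/-- The vectors `w n q` produced by reading the base-`M` digits of `q`: the leading digits select the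
starting vector `e`, and each of the `n` following digits `d` applies `T d`. -/
def digitVec {ι : Type} (M : ℕ) (e : ℕ → ι → ℝ) (T : ℕ → (ι → ℝ) →ₗ[ℝ] (ι → ℝ)) :
    ℕ → ℕ → ι → ℝ
  | 0, q => e q
  | n + 1, q => T (q % M) (digitVec M e T n (q / M))

section Core

variable {ι : Type}

/-- One step of the digit recursion on pairs (fractional part, state vector). -/
noncomputable def digitStep (M : ℕ) (ε K : ℝ) (T : ℕ → (ι → ℝ) →ₗ[ℝ] (ι → ℝ))
    (z : ℝ × (ι → ℝ)) : ℝ × (ι → ℝ) :=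
  (softFract ε M (M * z.1),
    ∑ d ∈ Finset.range M, T d fun i => gate K (z.2 i) (digitSel ε (M * z.1) d))

/-- The starting pair of the digit recursion at the point `t` with amplitude `a`. -/
noncomputable def digitInit (L : ℕ) (ε K : ℝ) (e : ℕ → ι → ℝ) (t a : ℝ) : ℝ × (ι → ℝ) :=
  (softFract ε L t, ∑ d ∈ Finset.range L, gate K a (digitSel ε t d) • e d)

theorem iterate_digitStep_fst {M L : ℕ} (ε K : ℝ) (e : ℕ → ι → ℝ)
    (T : ℕ → (ι → ℝ) →ₗ[ℝ] (ι → ℝ)) (t a : ℝ) (k : ℕ) :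
    ((digitStep M ε K T)^[k] (digitInit L ε K e t a)).1 =
      (fun x : ℝ => softFract ε M (M * x))^[k] (softFract ε L t) := by
  induction k with
  | zero => rfl
  | succ k ih => simp only [Function.iterate_succ_apply', ← ih, digitStep]

/-- With amplitude zero the state vector stays zero, whatever digits are read. -/
theorem iterate_digitStep_zero {M L : ℕ} (ε K : ℝ) (e : ℕ → ι → ℝ)
    (T : ℕ → (ι → ℝ) →ₗ[ℝ] (ι → ℝ)) (t : ℝ) (k : ℕ) :
    ((digitStep M ε K T)^[k] (digitInit L ε K e t 0)).2 = 0 := by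
  induction k with
  | zero => simp [digitInit, gate_zero]
  | succ k ih =>
    simp only [Function.iterate_succ_apply', digitStep, ih, Pi.zero_apply,
      gate_zero]
    exact Finset.sum_eq_zero fun d _ => (T d).map_zero

/-- Where all digits are read correctly and the gates do not saturate, the recursion computes the
digit vectors times the amplitude. -/
theorem iterate_digitStep_eq {M L n : ℕ} {K t a : ℝ} (hM : 1 ≤ M) (e : ℕ → ι → ℝ)
    (T : ℕ → (ι → ℝ) →ₗ[ℝ] (ι → ℝ)) (ht : 0 ≤ t) (htL : t < L)
    (hf : Int.fract ((M : ℝ) ^ n * t) ≤ 3 / 4) (ha : |a| ≤ K)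
    (hK : ∀ k ≤ n, ∀ i, |a * digitVec M e T k ⌊(M : ℝ) ^ k * t⌋₊ i| ≤ K) (k : ℕ) (hk : k ≤ n) :
    (digitStep M (4 * (M : ℝ) ^ n)⁻¹ K T)^[k] (digitInit L (4 * (M : ℝ) ^ n)⁻¹ K e t a) =
      (Int.fract ((M : ℝ) ^ k * t), a • digitVec M e T k ⌊(M : ℝ) ^ k * t⌋₊) := by
  have hM' : (1 : ℝ) ≤ M := by exact_mod_cast hM
  have hfr : ∀ k ≤ n, _ := fun k hk => fract_pow_mul_le hM hk hf
  have hε : 0 < (4 * (M : ℝ) ^ n)⁻¹ := by positivity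
  generalize (4 * (M : ℝ) ^ n)⁻¹ = ε at hfr hε ⊢
  induction k with
  | zero =>
    have h0 := hfr 0 hk
    simp only [pow_zero, one_mul] at h0
    have hL : ⌊t⌋₊ < L := (Nat.floor_lt ht).2 htL
    simp [digitInit, digitVec, softFract_eq hε ht htL h0, digitSel_eq hε ht h0, gate_ite ha, hL]
  | succ k ih =>
    have hk' : k ≤ n := by omega
    set z := (M : ℝ) ^ k * t with hz
    have hz0 : 0 ≤ z := by positivity
    have hz1 : (M : ℝ) ^ (k + 1) * t = M * z := by rw [hz, pow_succ']; ring
    have h0 : 0 ≤ (M : ℝ) * Int.fract z := mul_nonneg (by linarith) (Int.fract_nonneg z)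
    have h1 : (M : ℝ) * Int.fract z < M := by
      have := Int.fract_lt_one z
      nlinarith
    have h2 : Int.fract ((M : ℝ) * Int.fract z) ≤ 1 - ε := by
      rw [fract_natCast_mul_fract, ← hz1]
      exact hfr _ hk
    have h3 : ⌊(M : ℝ) * z⌋₊ / M = ⌊z⌋₊ := by
      rw [← Nat.floor_div_natCast, mul_div_cancel_left₀]
      linarith
    have hKk := hK k hk'
    rw [Function.iterate_succ_apply', ih hk', hz1]
    refine Prod.ext ?_ ?_
    · simp only [digitStep]
      rw [softFract_eq hε h0 h1 h2, fract_natCast_mul_fract]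
    · have hg : ∀ d, (fun i => gate K ((a • digitVec M e T k ⌊z⌋₊) i)
          (digitSel ε (M * Int.fract z) d)) =
          if ⌊(M : ℝ) * z⌋₊ % M = d then a • digitVec M e T k ⌊z⌋₊ else 0 := fun d => by
        ext i
        rw [digitSel_eq hε h0 h2, natFloor_mul_fract hM hz0, Pi.smul_apply, smul_eq_mul,
          gate_ite (hKk i)]
        split_ifs <;> rfl
      simp only [digitStep, hg, digitVec, h3]
      rw [Finset.sum_eq_single (⌊(M : ℝ) * z⌋₊ % M)]
      · rw [if_pos rfl, map_smul]
      · intro d _ hd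
        rw [if_neg hd.symm, map_zero]
      · intro h
        exact absurd (Finset.mem_range.2 (Nat.mod_lt _ hM)) h

variable [Fintype ι] {P : Type*} {δ : P → ℕ} {E : Type} [AddCommGroup E] [Module ℝ E]

theorem Realizable.digitSel (hδ : ∀ p, 1 ≤ δ p) (ε : P → ℝ) {u : P → E → ℝ}
    (hu : Realizable δ u) (d : ℕ) : Realizable δ (fun p x => digitSel (ε p) (u p x) d) := by
  have h : ∀ i : ℝ, Realizable δ (fun p x => ramp (ε p) (u p x) i) := fun i => by
    have := (Realizable.const (fun _ => (1 : ℝ))).min hδ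
      (((((hu.sub (Realizable.const fun _ => i))).const_mul fun p => (ε p)⁻¹).add
        (Realizable.const fun _ => 1)).max_zero hδ)
    simpa only [ramp, mul_comm] using this
  exact (h _).sub (h _)

theorem Realizable.softFract (hδ : ∀ p, 1 ≤ δ p) (ε : P → ℝ) (N : ℕ) {u : P → E → ℝ}
    (hu : Realizable δ u) : Realizable δ (fun p x => softFract (ε p) N (u p x)) :=
  hu.sub (Realizable.sum _ fun d _ => (Realizable.digitSel hδ ε hu d).const_mul fun _ => (d : ℝ))

theorem Realizable.zigzag (hδ : ∀ p, 1 ≤ δ p) (N : ℕ) {u : P → E → ℝ}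
    (hu : Realizable δ u) : Realizable δ (fun p x => zigzag N (u p x)) :=
  Realizable.sum _ fun d _ => by
    have := hu.sub (Realizable.const fun _ => (d : ℝ))
    exact (this.min hδ ((Realizable.const fun _ => (1 : ℝ)).sub this)).max_zero hδ

theorem Realizable.gate (hδ : ∀ p, 1 ≤ δ p) (K : P → ℝ) {v c : P → E → ℝ}
    (hv : Realizable δ v) (hc : Realizable δ c) :
    Realizable δ (fun p x => gate (K p) (v p x) (c p x)) := by
  have h := ((Realizable.const (fun _ => (1 : ℝ))).sub hc).const_mul K
  have h' := hv.const_mul fun _ => -1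
  simp only [neg_one_mul] at h'
  exact ((hv.sub h).max_zero hδ).sub ((h'.sub h).max_zero hδ)

theorem Realizable.digitStep (hδ : ∀ p, 1 ≤ δ p) (M : ℕ) (ε K : P → ℝ)
    (T : P → ℕ → (ι → ℝ) →ₗ[ℝ] (ι → ℝ)) :
    Realizable δ (fun p z => digitStep M (ε p) (K p) (T p) z) := by
  have hx : Realizable δ (fun (_ : P) (z : ℝ × (ι → ℝ)) => (M : ℝ) * z.1) :=
    (Realizable.linear fun _ => LinearMap.fst ℝ ℝ (ι → ℝ)).const_mul fun _ => (M : ℝ)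
  have hv : ∀ i, Realizable δ (fun (_ : P) (z : ℝ × (ι → ℝ)) => z.2 i) := fun i =>
    Realizable.linear fun _ => LinearMap.proj i ∘ₗ LinearMap.snd ℝ ℝ (ι → ℝ)
  exact (Realizable.softFract hδ ε M hx).prodMk (Realizable.sum _ fun d _ =>
    (Realizable.linear fun p => T p d).comp
      (Realizable.pi fun i => Realizable.gate hδ K (hv i) (Realizable.digitSel hδ ε hx d)))

/-- The function `t ↦ h (fract (M ^ n * t)) • w n ⌊M ^ n * t⌋` on `[0, L)`, with digit vectors
`w`, is computed in linear depth if `h` vanishes near the integers. A first pass over the digits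
yields the amplitude `h (fract (M ^ n * t))`, clipped to zero near the discontinuities with the
exact zigzag guard; a second pass applies the maps `T d` to it. Since the second pass is linear in
the amplitude, wrongly read digits do no harm where the amplitude vanishes. -/
theorem realizable_digitVec {M L : ℕ} (hM : 1 ≤ M) (n : P → ℕ) {h : P → ℝ → ℝ}
    (hh : Realizable (fun _ => 1) h) (hb : ∀ p, ∃ K, ∀ y, |h p y| ≤ K)
    (hs : ∀ p y, y ∉ Set.Icc (3 / 8 : ℝ) (5 / 8) → h p y = 0)
    (e : P → ℕ → ι → ℝ) (T : P → ℕ → (ι → ℝ) →ₗ[ℝ] (ι → ℝ)) :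
    Realizable (fun p => n p + 1) (fun p (t : ℝ) => (if 0 ≤ t ∧ t < L then
      h p (Int.fract ((M : ℝ) ^ n p * t)) • digitVec M (e p) (T p) (n p) ⌊(M : ℝ) ^ n p * t⌋₊
      else 0 : ι → ℝ)) := by
  have hM' : (1 : ℝ) ≤ M := by exact_mod_cast hM
  choose H hH using hb
  have hH0 : ∀ p, 0 ≤ H p := fun p => (abs_nonneg _).trans (hH p 0)
  let ε : P → ℝ := fun p => (4 * (M : ℝ) ^ n p)⁻¹
  -- Only finitely many digit vectors occur, so a common bound for the gates exists.
  have hK : ∀ p, ∃ K, H p ≤ K ∧ ∀ k ≤ n p, ∀ q ≤ L * M ^ n p, ∀ i,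
      H p * |digitVec M (e p) (T p) k q i| ≤ K := by
    intro p
    obtain ⟨K, hK⟩ := (Set.toFinite (Set.range fun z : Fin (n p + 1) × Fin (L * M ^ n p + 1) × ι =>
      H p * |digitVec M (e p) (T p) z.1 z.2.1 z.2.2|)).bddAbove
    refine ⟨max K (H p), le_max_right _ _, fun k hk q hq i => le_max_of_le_left (hK ?_)⟩
    exact ⟨(⟨k, by omega⟩, ⟨q, by omega⟩, i), rfl⟩
  choose K hHK hK using hK
  let δ : P → ℕ := fun p => n p + 1
  have hδ : ∀ p, 1 ≤ δ p := fun p => Nat.le_add_left _ _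
  have hn : ∀ p, n p ≤ δ p := fun p => Nat.le_succ _
  -- `y` is the approximate fractional part of `M ^ n * t`, `g` the exact distance of `M ^ n * t` to
  -- the integers, `b` the clipping level for the amplitude `a`. Where the bump may be nonzero, `g` is
  -- at least `3 / 8`, so the factor `8` keeps `b` above the bound `H`; digits are correct for
  -- `g > 1 / 4`.
  let y : P → ℝ → ℝ := fun p t =>
    (fun x : ℝ => softFract (ε p) M (M * x))^[n p] (softFract (ε p) L t)
  let g : P → ℝ → ℝ := fun p t => (fun s : ℝ => zigzag M (M * s))^[n p] (zigzag L t)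
  let b : P → ℝ → ℝ := fun p t => 8 * H p * max (g p t - 1 / 4) 0
  let a : P → ℝ → ℝ := fun p t => min (max (h p (y p t)) (-b p t)) (b p t)
  have hmul : Realizable (fun _ : P => 1) (fun _ x => (M : ℝ) * x) :=
    Realizable.id.const_mul fun _ => (M : ℝ)
  have hy : Realizable δ y :=
    ((Realizable.iterate n (Realizable.softFract (fun _ => le_rfl) ε M hmul)).mono hn).comp
      (Realizable.softFract hδ ε L Realizable.id)
  have hg : Realizable δ g :=
    ((Realizable.iterate n (Realizable.zigzag (fun _ => le_rfl) M hmul)).mono hn).comp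
      (Realizable.zigzag hδ L Realizable.id)
  have hbr : Realizable δ b :=
    ((hg.sub (Realizable.const fun _ => 1 / 4)).max_zero hδ).const_mul fun p => 8 * H p
  have hbn : Realizable δ (fun p t => -b p t) := by
    simpa using hbr.const_mul fun _ => -1
  have ha : Realizable δ a := (((hh.mono hδ).comp hy).max hδ hbn).min hδ hbr
  have hinit : Realizable δ (fun p t => digitInit L (ε p) (K p) (e p) t (a p t)) :=
    (Realizable.softFract hδ ε L Realizable.id).prodMk (Realizable.sum _ fun d _ =>
      (Realizable.gate hδ K ha (Realizable.digitSel hδ ε Realizable.id d)).smul_vec _)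
  have hfin := (Realizable.linear (δ := δ) fun _ : P => LinearMap.snd ℝ ℝ (ι → ℝ)).comp
    (((Realizable.iterate n (Realizable.digitStep (fun _ => le_rfl) M ε K T)).mono hn).comp hinit)
  convert hfin using 3 with p t
  change _ = ((digitStep M (ε p) (K p) (T p))^[n p] (digitInit L (ε p) (K p) (e p) t (a p t))).2
  have hgt : g p t = if 0 ≤ t ∧ t < L then intDist ((M : ℝ) ^ n p * t) else 0 :=
    iterate_zigzag hM (n p) t
  have hb0 : 0 ≤ b p t := mul_nonneg (by linarith [hH0 p]) (le_max_right _ _)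
  by_cases hgood : 1 / 4 < g p t
  · have htL : 0 ≤ t ∧ t < L := by
      by_contra hcon
      rw [hgt, if_neg hcon] at hgood
      norm_num at hgood
    rw [if_pos htL]
    rw [if_pos htL] at hgt
    have hfr : Int.fract ((M : ℝ) ^ n p * t) ≤ 3 / 4 := by
      have := hgood.trans_le (hgt.le.trans (min_le_right _ _))
      linarith
    have hyt : y p t = Int.fract ((M : ℝ) ^ n p * t) := by
      have := iterate_digitStep_eq (K := 0) hM (0 : ℕ → ι → ℝ) (T p) htL.1 htL.2 hfr
        (a := 0) (by simp) (by simp) (n p) le_rfl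
      simpa only [iterate_digitStep_fst] using congrArg Prod.fst this
    have hat : a p t = h p (Int.fract ((M : ℝ) ^ n p * t)) := by
      have hle : |h p (y p t)| ≤ b p t := by
        by_cases hmem : y p t ∈ Set.Icc (3 / 8 : ℝ) (5 / 8)
        · have h3 : 3 / 8 ≤ g p t := by
            rw [hgt, intDist, ← hyt]
            exact le_min hmem.1 (by linarith [hmem.2])
          have : 1 / 8 ≤ max (g p t - 1 / 4) 0 := le_max_of_le_left (by linarith)
          have h4 := hH p (y p t)
          have h5 : 8 * H p * (1 / 8) ≤ b p t :=
            mul_le_mul_of_nonneg_left this (by linarith [hH0 p])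
          linarith
        · rw [hs p _ hmem, abs_zero]
          exact hb0
      have := abs_le.1 hle
      rw [← hyt]
      change min (max (h p (y p t)) (-b p t)) (b p t) = _
      rw [max_eq_left this.1, min_eq_left this.2]
    have haH : |a p t| ≤ H p := hat ▸ hH p _
    rw [iterate_digitStep_eq hM (e p) (T p) htL.1 htL.2 hfr (haH.trans (hHK p)) ?_ (n p) le_rfl,
      hat]
    intro k hk i
    rw [abs_mul]
    refine (mul_le_mul_of_nonneg_right haH (abs_nonneg _)).trans (hK p k hk _ ?_ i)
    refine Nat.floor_le_of_le ?_
    push_cast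
    rw [mul_comm]
    exact mul_le_mul htL.2.le (pow_le_pow_right₀ hM' hk) (by positivity) (by positivity)
  · have ha0 : a p t = 0 := by
      have : b p t = 0 := by
        change 8 * H p * max (g p t - 1 / 4) 0 = 0
        rw [max_eq_right (by linarith), mul_zero]
      change min (max (h p (y p t)) (-b p t)) (b p t) = 0
      rw [this, neg_zero]
      exact min_eq_right (le_max_right _ _)
    rw [ha0, iterate_digitStep_zero]
    split_ifs with htL
    · rw [if_pos htL] at hgt
      rw [hs, zero_smul]
      rintro ⟨h1, h2⟩
      refine hgood ?_
      rw [hgt, intDist]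
      exact lt_min (by linarith) (by linarith)
    · rfl

end Core

/-! ### The linear refinement operator in coordinates -/

section RefineLin

variable {κ : Type} [Fintype κ]

/-- The linear part of the refinement operator, acting on scalar coordinate functions, with the
shifts `j` restricted to the interval `[0, (M - 1) L]` that is compatible with the window. -/
noncomputable def refineLin (M L : ℕ) (A : κ → κ → ℤ → ℝ) :
    (κ → ℝ → ℝ) →ₗ[ℝ] (κ → ℝ → ℝ) where
  toFun g α t := ∑ j ∈ Finset.Icc (0 : ℤ) ((M - 1) * L), ∑ β, A α β j * g β (M * t - j)
  map_add' g h := by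
    ext α t
    simp only [Pi.add_apply, mul_add, Finset.sum_add_distrib]
  map_smul' c g := by
    ext α t
    simp only [Pi.smul_apply, smul_eq_mul, Finset.mul_sum, RingHom.id_apply, mul_left_comm c]

theorem refineLin_apply (M L : ℕ) (A : κ → κ → ℤ → ℝ) (g : κ → ℝ → ℝ) (α : κ) (t : ℝ) :
    refineLin M L A g α t =
      ∑ j ∈ Finset.Icc (0 : ℤ) ((M - 1) * L), ∑ β, A α β j * g β (M * t - j) := rfl

/-- All coordinate functions vanish outside the open window `(0, L)`. -/
def VanishesOff (L : ℕ) (g : κ → ℝ → ℝ) : Prop := ∀ β, ∀ t ∉ Set.Ioo (0 : ℝ) L, g β t = 0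

theorem VanishesOff.refineLin {M L : ℕ} (hM : 1 ≤ M) {A : κ → κ → ℤ → ℝ} {g : κ → ℝ → ℝ}
    (hg : VanishesOff L g) : VanishesOff L (refineLin M L A g) := by
  intro α t ht
  have hM' : (1 : ℝ) ≤ M := by exact_mod_cast hM
  rw [refineLin_apply]
  refine Finset.sum_eq_zero fun j hj => Finset.sum_eq_zero fun β _ => ?_
  rw [hg β, mul_zero]
  rintro ⟨h1, h2⟩
  have hj1 : (0 : ℝ) ≤ j := by exact_mod_cast (Finset.mem_Icc.1 hj).1
  have hj2 : (j : ℝ) ≤ (M - 1) * L := by exact_mod_cast (Finset.mem_Icc.1 hj).2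
  exact ht ⟨by by_contra! h; nlinarith, by by_contra! h; nlinarith⟩

theorem VanishesOff.refineLin_pow {M L : ℕ} (hM : 1 ≤ M) {A : κ → κ → ℤ → ℝ} {g : κ → ℝ → ℝ}
    (hg : VanishesOff L g) (n : ℕ) : VanishesOff L ((ReLURefinement.refineLin M L A ^ n) g) := by
  induction n with
  | zero => simpa using hg
  | succ n ih =>
    rw [pow_succ', Module.End.mul_apply]
    exact ih.refineLin hM

/-- A shift of the initial curves by `s` becomes a shift by `s / M ^ n` after `n` steps. -/
theorem refineLin_pow_shift {M L : ℕ} (hM : 1 ≤ M) (A : κ → κ → ℤ → ℝ) (n : ℕ) (s : ℝ)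
    (g : κ → ℝ → ℝ) (α : κ) (t : ℝ) :
    (refineLin M L A ^ n) (fun β t => g β (t - s)) α t =
      (refineLin M L A ^ n) g α (t - s / M ^ n) := by
  have hM' : (M : ℝ) ≠ 0 := by exact_mod_cast (by omega : M ≠ 0)
  induction n generalizing s g with
  | zero => simp
  | succ n ih =>
    have h : refineLin M L A (fun β t => g β (t - s)) =
        fun β t => refineLin M L A g β (t - s / M) := by
      ext α t
      simp only [refineLin_apply]
      refine Finset.sum_congr rfl fun j _ => Finset.sum_congr rfl fun β _ => ?_
      congr 2
      field_simp
      ring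
    rw [pow_succ, Module.End.mul_apply, Module.End.mul_apply, h, ih, div_div, pow_succ']

/-- The digit maps of the refinement operator, acting on rows of `L` blocks. -/
noncomputable def digitMap (M L : ℕ) (A : κ → κ → ℤ → ℝ) (d : ℕ) :
    (Fin L × κ → ℝ) →ₗ[ℝ] (Fin L × κ → ℝ) :=
  Matrix.vecMulLinear (Matrix.of fun x y => A x.2 y.2 ((M * x.1.1 + d : ℕ) - (y.1.1 : ℤ)))

/-- The starting rows: evaluation of the coordinate `α` in the unit interval number `q`. -/
def digitStart [DecidableEq κ] (L : ℕ) (α : κ) (q : ℕ) : Fin L × κ → ℝ :=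
  fun x => if q = x.1 ∧ α = x.2 then 1 else 0

/-- For `y ∈ [0, 1)` only the `L` arguments `y, y + 1, …, y + L - 1` matter to a function that
vanishes off `(0, L)`. -/
theorem sum_shift_eq {L : ℕ} {N : ℤ} {a : ℤ → ℝ} (ha : ∀ j ∉ Finset.Icc 0 N, a j = 0) {g : ℝ → ℝ}
    (hg : ∀ t ∉ Set.Ioo (0 : ℝ) L, g t = 0) (c : ℤ) {y : ℝ} (hy0 : 0 ≤ y) (hy1 : y < 1) :
    ∑ j ∈ Finset.Icc 0 N, a j * g (y + c - j) = ∑ l : Fin L, a (c - (l.1 : ℤ)) * g (y + l.1) := by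
  have h1 : ∑ j ∈ Finset.Icc 0 N, a j * g (y + c - j) = ∑ᶠ j : ℤ, a j * g (y + c - j) := by
    refine (finsum_eq_sum_of_support_subset _ fun j hj => ?_).symm
    by_contra h
    exact hj (by simp only [ha j h, zero_mul])
  have h2 : ∑ᶠ j : ℤ, a j * g (y + c - j) = ∑ᶠ l : ℤ, a (c - l) * g (y + l) := by
    rw [← finsum_comp_equiv (Equiv.subLeft c)]
    refine finsum_congr fun l => ?_
    simp only [Equiv.subLeft_apply]
    push_cast
    ring_nf
  rw [h1, h2, Fin.sum_univ_eq_sum_range (fun l : ℕ => a (c - (l : ℤ)) * g (y + l)),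
    finsum_eq_sum_of_support_subset (s := (Finset.range L).map Nat.castEmbedding)]
  · simp
  · intro l hl
    have hmem : y + l ∈ Set.Ioo (0 : ℝ) L := by
      by_contra h
      exact hl (by simp only [hg _ h, mul_zero])
    have hl0 : (-1 : ℝ) < l := by linarith [hmem.1]
    have hl1 : (l : ℝ) < L := by linarith [hmem.2]
    have hl0' : -1 < l := by exact_mod_cast hl0
    have hl1' : l < L := by exact_mod_cast hl1
    obtain ⟨k, rfl⟩ := Int.eq_ofNat_of_zero_le (by omega : 0 ≤ l)
    simpa using hl1'

/-- Iterates of the refinement operator in terms of base-`M` digits: on each interval of length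
`M⁻ⁿ` the `n`-th iterate is a fixed row applied to the `L` pieces of the initial curves. -/
theorem refineLin_pow_eq_digitVec [DecidableEq κ] {M L : ℕ} (hM : 1 ≤ M) {A : κ → κ → ℤ → ℝ}
    (hA : ∀ α β, ∀ j ∉ Finset.Icc (0 : ℤ) ((M - 1) * L), A α β j = 0) {g : κ → ℝ → ℝ}
    (hg : VanishesOff L g) (n : ℕ) (α : κ) {t : ℝ} (ht : 0 ≤ t) (htL : t < L) :
    (refineLin M L A ^ n) g α t =
      ∑ x : Fin L × κ, digitVec M (digitStart L α) (digitMap M L A) n ⌊(M : ℝ) ^ n * t⌋₊ x *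
        g x.2 (Int.fract ((M : ℝ) ^ n * t) + x.1.1) := by
  induction n generalizing g with
  | zero =>
    have hL : ⌊t⌋₊ < L := (Nat.floor_lt ht).2 htL
    have h2 : Int.fract t + ⌊t⌋₊ = t := by
      rw [natCast_floor_eq_intCast_floor ht]; exact Int.fract_add_floor t
    rw [Finset.sum_eq_single (⟨⌊t⌋₊, hL⟩, α)]
    · simp [digitVec, digitStart, h2]
    · rintro ⟨l, β⟩ _ hx
      simp only [digitVec, digitStart, pow_zero, one_mul]
      rw [if_neg, zero_mul]
      rintro ⟨h, rfl⟩
      exact hx (Prod.ext (Fin.ext h.symm) rfl)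
    · intro h
      exact absurd (Finset.mem_univ _) h
  | succ n ih =>
    rw [pow_succ, Module.End.mul_apply, ih (hg.refineLin hM)]
    set z := (M : ℝ) ^ n * t with hz
    have hz0 : 0 ≤ z := by positivity
    have hz1 : (M : ℝ) ^ (n + 1) * t = M * z := by rw [hz, pow_succ']; ring
    have h3 : ⌊(M : ℝ) * z⌋₊ / M = ⌊z⌋₊ := by
      rw [← Nat.floor_div_natCast, mul_div_cancel_left₀]
      exact_mod_cast (by omega : M ≠ 0)
    set d := ⌊(M : ℝ) * z⌋₊ % M with hd
    have hMy : (M : ℝ) * Int.fract z = Int.fract (M * z) + d := by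
      rw [← fract_natCast_mul_fract, hd, ← natFloor_mul_fract hM hz0,
        natCast_floor_eq_intCast_floor (by have := Int.fract_nonneg z; positivity)]
      exact (Int.fract_add_floor _).symm
    have hV : ∀ x : Fin L × κ, refineLin M L A g x.2 (Int.fract z + x.1.1) =
        ∑ y : Fin L × κ, A x.2 y.2 ((M * x.1.1 + d : ℕ) - (y.1.1 : ℤ)) *
          g y.2 (Int.fract (M * z) + y.1.1) := by
      intro x
      rw [Fintype.sum_prod_type_right, refineLin_apply, Finset.sum_comm]
      refine Finset.sum_congr rfl fun β _ => ?_
      rw [← sum_shift_eq (hA x.2 β) (hg β) _ (Int.fract_nonneg _) (Int.fract_lt_one _)]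
      refine Finset.sum_congr rfl fun j _ => ?_
      congr 2
      rw [mul_add, hMy]
      push_cast
      ring
    simp only [hV, hz1, digitVec, h3, ← hd, digitMap, Matrix.vecMulLinear_apply, Matrix.vecMul,
      dotProduct, Finset.mul_sum, Finset.sum_mul, Matrix.of_apply]
    rw [Finset.sum_comm]
    simp only [mul_assoc]

variable {P : Type*}

/-- Iterates of the refinement operator on one small bump in one coordinate, the bump being placed
anywhere. -/
theorem realizable_refineLin_pow_bump [DecidableEq κ] {M L : ℕ} (hM : 1 ≤ M) (hL : 1 ≤ L) (n : P → ℕ)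
    {A : P → κ → κ → ℤ → ℝ}
    (hA : ∀ p α β, ∀ j ∉ Finset.Icc (0 : ℤ) ((M - 1) * L), A p α β j = 0)
    {h : P → ℝ → ℝ} (hh : Realizable (fun _ => 1) h) (hb : ∀ p, ∃ K, ∀ y, |h p y| ≤ K)
    (hs : ∀ p y, y ∉ Set.Icc (3 / 8 : ℝ) (5 / 8) → h p y = 0) (β : κ) (s : ℝ) :
    Realizable (fun p => n p + 1) (fun p t α =>
      (refineLin M L (A p) ^ n p) (Pi.single β fun t => h p (t - s)) α t) := by
  refine Realizable.pi fun α => ?_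
  have h1 := (Realizable.linear (δ := fun p => n p + 1) fun _ : P =>
    LinearMap.proj (R := ℝ) (φ := fun _ : Fin L × κ => ℝ) (⟨0, hL⟩, β)).comp
    ((realizable_digitVec (L := L) hM n hh hb hs (fun _ => digitStart L α)
      fun p => digitMap M L (A p)).comp
        (Realizable.affine (fun _ => LinearMap.id) fun p => -(s / (M : ℝ) ^ n p)))
  convert h1 using 3 with p t
  have hsingle : (Pi.single β fun t => h p (t - s) : κ → ℝ → ℝ) =
      fun γ t => (Pi.single β (h p) : κ → ℝ → ℝ) γ (t - s) := by
    ext γ t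
    by_cases hγ : γ = β
    · subst hγ; simp
    · simp [hγ]
  have hL' : (1 : ℝ) ≤ L := by exact_mod_cast hL
  have hoff : VanishesOff L (Pi.single β (h p) : κ → ℝ → ℝ) := by
    intro γ u hu
    by_cases hγ : γ = β
    · subst hγ
      rw [Pi.single_eq_same]
      refine hs p u fun hu' => hu ⟨by linarith [hu'.1], by linarith [hu'.2]⟩
    · simp [hγ]
  rw [hsingle, refineLin_pow_shift hM]
  simp only [LinearMap.id_apply, LinearMap.proj_apply, ← sub_eq_add_neg]
  generalize t - s / (M : ℝ) ^ n p = u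
  split_ifs with hu
  · rw [refineLin_pow_eq_digitVec hM (hA p) hoff (n p) α hu.1 hu.2,
      Finset.sum_eq_single (⟨0, hL⟩, β)]
    · simp [mul_comm]
    · rintro ⟨l, γ⟩ _ hx
      by_cases hγ : γ = β
      · subst hγ
        have hl : 1 ≤ l.1 := by
          by_contra! h0
          exact hx (Prod.ext (Fin.ext (by simpa using h0)) rfl)
        have hl' : (1 : ℝ) ≤ l.1 := by exact_mod_cast hl
        rw [Pi.single_eq_same, hs, mul_zero]
        rintro ⟨_, h2⟩
        linarith [Int.fract_nonneg ((M : ℝ) ^ n p * u)]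
      · simp [hγ]
    · intro h
      exact absurd (Finset.mem_univ _) h
  · exact hoff.refineLin_pow hM (n p) α u fun hu' => hu ⟨hu'.1.le, hu'.2⟩

end RefineLin

/-! ### Decomposition into small bumps -/

/-- The bump number `j` of the function `g` for the grid of step `1 / 8`: the hat function at `j / 8`
with height `g (j / 8)`, plus the deviation of `g` from its linear interpolant on the interval
`[j / 8, (j + 1) / 8]`. -/
noncomputable def bump (g : ℝ → ℝ) (j : ℕ) (t : ℝ) : ℝ :=
  g (j / 8) * max (min (8 * t - j + 1) (1 - (8 * t - j))) 0 +
    (g (max (min t ((j + 1) / 8)) (j / 8)) - g (j / 8) -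
      (g ((j + 1) / 8) - g (j / 8)) * (8 * max (min t ((j + 1) / 8)) (j / 8) - j))

theorem bump_of_le {g : ℝ → ℝ} {j : ℕ} {t : ℝ} (ht : 8 * t ≤ j - 1) : bump g j t = 0 := by
  rw [bump, max_eq_right (min_le_of_left_le (by linarith)),
    max_eq_right (min_le_of_left_le (by linarith))]
  ring

theorem bump_of_ge {g : ℝ → ℝ} {j : ℕ} {t : ℝ} (ht : (j : ℝ) + 1 ≤ 8 * t) : bump g j t = 0 := by
  rw [bump, max_eq_right (min_le_of_right_le (by linarith)), min_eq_right (by linarith),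
    max_eq_left (by linarith)]
  ring

theorem sum_bump {L : ℕ} {g : ℝ → ℝ} (hg : ∀ t ∉ Set.Ioo (0 : ℝ) L, g t = 0) (t : ℝ) :
    ∑ j ∈ Finset.range (8 * L), bump g j t = g t := by
  have hg0 : g 0 = 0 := hg 0 (by simp)
  by_cases ht : t ∈ Set.Ioo (0 : ℝ) L
  · obtain ⟨ht0, htL⟩ := ht
    set i := ⌊8 * t⌋₊
    have hi1 : (i : ℝ) ≤ 8 * t := Nat.floor_le (by linarith)
    have hi2 : 8 * t < i + 1 := Nat.lt_floor_add_one _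
    have hiL : i < 8 * L := (Nat.floor_lt (by linarith)).2 (by push_cast; linarith)
    -- Only the bumps `i` and `i + 1` contribute; the hat parts restore the linear interpolant.
    have hterm : ∀ j : ℕ, bump g j t =
        (if i = j then g t - g ((i + 1 : ℝ) / 8) * (8 * t - i) else 0) +
          if i + 1 = j then g ((i + 1 : ℝ) / 8) * (8 * t - i) else 0 := by
      intro j
      rcases lt_trichotomy j i with h | rfl | h
      · have : (j : ℝ) + 1 ≤ i := by exact_mod_cast h
        rw [bump_of_ge (by linarith), if_neg (by omega), if_neg (by omega), add_zero]
      · rw [if_pos rfl, if_neg (by omega), bump, min_eq_right (a := 8 * t - _ + 1) (by linarith),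
          max_eq_left (b := (0 : ℝ)) (by linarith), min_eq_left (by linarith),
          max_eq_left (by linarith)]
        ring
      · rw [if_neg (by omega)]
        by_cases h' : i + 1 = j
        · have hj : (j : ℝ) = i + 1 := by exact_mod_cast h'.symm
          rw [if_pos h', bump, hj, min_eq_left (a := 8 * t - _ + 1) (by linarith),
            max_eq_left (b := (0 : ℝ)) (by linarith),
            max_eq_right (min_le_of_left_le (by linarith))]
          ring
        · have : (i : ℝ) + 2 ≤ j := by exact_mod_cast (by omega : i + 2 ≤ j)
          rw [if_neg h', bump_of_le (by linarith), add_zero]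
    simp only [hterm, Finset.sum_add_distrib, Finset.sum_ite_eq, Finset.mem_range, if_pos hiL]
    split_ifs with h
    · ring
    · have h8 : (i : ℝ) + 1 = 8 * L := by exact_mod_cast (by omega : i + 1 = 8 * L)
      have hL : ((i : ℝ) + 1) / 8 = L := by linarith
      rw [hL, hg L (by simp)]
      ring
  · rw [hg t ht]
    refine Finset.sum_eq_zero fun j hj => ?_
    have hjL : (j : ℝ) + 1 ≤ 8 * L := by exact_mod_cast Finset.mem_range.1 hj
    by_cases ht0 : 0 < t
    · have : (L : ℝ) ≤ t := by
        by_contra! h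
        exact ht ⟨ht0, h⟩
      exact bump_of_ge (by linarith)
    · rcases Nat.eq_zero_or_pos j with rfl | hj0
      · rw [bump, max_eq_right (a := min t _) (min_le_of_left_le (by simpa using not_lt.1 ht0))]
        simp [hg0]
      · have : (1 : ℝ) ≤ j := by exact_mod_cast hj0
        exact bump_of_le (by linarith [not_lt.1 ht0])

theorem continuous_bump {g : ℝ → ℝ} (hg : Continuous g) (j : ℕ) : Continuous (bump g j) := by
  unfold bump
  fun_prop

theorem Realizable.bump {P : Type*} {g : P → ℝ → ℝ} (hg : Realizable (fun _ => 1) g) (j : ℕ) :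
    Realizable (fun _ => 1) (fun p => bump (g p) j) := by
  have hδ : ∀ p : P, 1 ≤ (fun _ : P => 1) p := fun _ => le_rfl
  have hid : Realizable (fun _ : P => 1) (fun _ (t : ℝ) => t) := Realizable.id
  have hc := ((hid.min hδ (Realizable.const fun _ => ((j : ℝ) + 1) / 8))).max hδ
    (Realizable.const fun _ => (j : ℝ) / 8)
  have hu := (hid.const_mul fun _ => 8).sub (Realizable.const fun _ => (j : ℝ))
  have h1 := ((hu.add (Realizable.const fun _ => 1)).min hδ
    ((Realizable.const fun _ => 1).sub hu)).max_zero hδ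
  have h2 := ((hg.comp hc).sub (Realizable.const fun p => g p (j / 8))).sub
    (((hc.const_mul fun _ => 8).sub (Realizable.const fun _ => (j : ℝ))).const_mul
      fun p => g p ((j + 1) / 8) - g p (j / 8))
  exact (h1.const_mul fun p => g p (j / 8)).add h2

/-- Iterates of the linear refinement operator are computed in linear depth. -/
theorem realizable_refineLin_pow {P : Type*} {κ : Type} [Fintype κ] {M L : ℕ} (hM : 1 ≤ M)
    (hL : 1 ≤ L) (n : P → ℕ) {A : P → κ → κ → ℤ → ℝ}
    (hA : ∀ p α β, ∀ j ∉ Finset.Icc (0 : ℤ) ((M - 1) * L), A p α β j = 0)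
    {g : P → κ → ℝ → ℝ} (hg : ∀ β, Realizable (fun _ => 1) (fun p => g p β))
    (hc : ∀ p β, Continuous (g p β)) (hoff : ∀ p, VanishesOff L (g p)) :
    Realizable (fun p => n p + 1) (fun p t α => (refineLin M L (A p) ^ n p) (g p) α t) := by
  classical
  have hbump : ∀ (β : κ) (j : ℕ), Realizable (fun p => n p + 1) (fun p t α =>
      (refineLin M L (A p) ^ n p) (Pi.single β (bump (g p β) j)) α t) := by
    intro β j
    have hs : ∀ p y, y ∉ Set.Icc (3 / 8 : ℝ) (5 / 8) →
        bump (g p β) j (y + ((j : ℝ) / 8 - 1 / 2)) = 0 := by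
      intro p y hy
      by_cases h : 3 / 8 ≤ y
      · exact bump_of_ge (by linarith [lt_of_not_ge fun h' => hy ⟨h, h'⟩])
      · exact bump_of_le (by linarith [not_le.1 h])
    have hh : Realizable (fun _ => 1) (fun p y => bump (g p β) j (y + ((j : ℝ) / 8 - 1 / 2))) :=
      ((hg β).bump j).comp (Realizable.affine (fun _ => LinearMap.id) fun _ => _)
    have hb : ∀ p, ∃ K, ∀ y, |bump (g p β) j (y + ((j : ℝ) / 8 - 1 / 2))| ≤ K := fun p =>
      ((continuous_bump (hc p β) j).comp (continuous_add_const _)).bounded_above_of_compact_support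
        (HasCompactSupport.intro isCompact_Icc (hs p))
    simpa only [sub_add_cancel] using
      realizable_refineLin_pow_bump hM hL n hA hh hb hs β ((j : ℝ) / 8 - 1 / 2)
  have := Realizable.sum Finset.univ fun β _ => Realizable.sum (Finset.range (8 * L))
    fun j _ => hbump β j
  convert this using 3 with p t
  ext α
  have hdec : g p = ∑ β, ∑ j ∈ Finset.range (8 * L), Pi.single β (bump (g p β) j) := by
    ext γ u
    simp only [Finset.sum_apply]
    rw [Finset.sum_eq_single γ]
    · simp [sum_bump (hoff p γ)]
    · intro β _ hβ
      simp [Pi.single_eq_of_ne hβ.symm]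
    · intro h
      exact absurd (Finset.mem_univ _) h
  conv_lhs => rw [hdec]
  simp only [map_sum, Finset.sum_apply]

/-! ### Continuous piecewise linear curves -/

theorem isCPwLWith_zero {p : ℕ} (m : ℕ) : IsCPwLWith m (fun _ => 0 : ℝ → Fin p → ℝ) :=
  ⟨continuous_const, ∅, by simp, fun _ _ _ _ => ⟨0, 0, by simp⟩⟩

theorem eq_of_affine_eqOn_Ioo {p : ℕ} {u v u' v' : Fin p → ℝ} {a b : ℝ} (hab : a < b)
    (h : ∀ t ∈ Set.Ioo a b, u + t • v = u' + t • v') : u = u' ∧ v = v' := by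
  obtain ⟨x, hx⟩ := exists_between hab
  obtain ⟨y, hy⟩ := exists_between hx.2
  have h1 := h x hx
  have h2 := h y ⟨hx.1.trans hy.1, hy.2⟩
  have hv : v = v' := by
    ext i
    have e1 := congrFun h1 i
    have e2 := congrFun h2 i
    simp only [Pi.add_apply, Pi.smul_apply, smul_eq_mul] at e1 e2
    have : (y - x) * (v i - v' i) = 0 := by linarith
    rcases mul_eq_zero.1 this with h | h
    · linarith [hy.1]
    · linarith
  subst hv
  exact ⟨add_right_cancel h1, rfl⟩

/-- A curve without breakpoints is affine. -/
theorem exists_affine_of_forall_Ioo {p : ℕ} {f : ℝ → Fin p → ℝ}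
    (h : ∀ a b : ℝ, a < b → ∃ u v : Fin p → ℝ, ∀ t ∈ Set.Ioo a b, f t = u + t • v) :
    ∃ u v : Fin p → ℝ, ∀ t, f t = u + t • v := by
  obtain ⟨u, v, huv⟩ := h 0 1 one_pos
  refine ⟨u, v, fun t => ?_⟩
  have hT : (-(|t| + 2)) < |t| + 2 := by linarith [abs_nonneg t]
  obtain ⟨u', v', huv'⟩ := h _ _ hT
  obtain ⟨rfl, rfl⟩ := eq_of_affine_eqOn_Ioo one_pos (u := u) (v := v) (u' := u') (v' := v')
    fun x hx => by
      rw [← huv x hx, huv' x ⟨by linarith [abs_nonneg t, hx.1], by linarith [abs_nonneg t, hx.2]⟩]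
  exact huv' t ⟨by linarith [neg_abs_le t], by linarith [le_abs_self t]⟩

/-- A breakpoint `s` can be removed by subtracting a multiple of `max (t - s) 0`. -/
theorem exists_sub_relu {p : ℕ} {f : ℝ → Fin p → ℝ} (hf : Continuous f) {S : Finset ℝ} {s : ℝ}
    (hs : s ∈ S) (h : ∀ a b : ℝ, a < b → (∀ x ∈ S, x ∉ Set.Ioo a b) →
      ∃ u v : Fin p → ℝ, ∀ t ∈ Set.Ioo a b, f t = u + t • v) :
    ∃ c : Fin p → ℝ, ∀ a b : ℝ, a < b → (∀ x ∈ S.erase s, x ∉ Set.Ioo a b) →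
      ∃ u v : Fin p → ℝ, ∀ t ∈ Set.Ioo a b, f t - max (t - s) 0 • c = u + t • v := by
  -- A neighbourhood of `s` without further breakpoints, and the slopes on its two sides.
  obtain ⟨ε, hε, hball⟩ := Metric.isOpen_iff.1 (S.erase s).finite_toSet.isClosed.isOpen_compl s
    (by simp)
  have hnear : ∀ x ∈ S, x ≠ s → x ∉ Set.Ioo (s - ε) (s + ε) := fun x hx hxs hx' =>
    hball (by rwa [Real.ball_eq_Ioo]) (Finset.mem_coe.2 (Finset.mem_erase.2 ⟨hxs, hx⟩))
  have hl : s - ε < s := by linarith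
  have hr : s < s + ε := by linarith
  obtain ⟨ul, vl, huvl⟩ := h (s - ε) s hl fun x hx hx' =>
    hnear x hx hx'.2.ne ⟨hx'.1, hx'.2.trans hr⟩
  obtain ⟨ur, vr, huvr⟩ := h s (s + ε) hr fun x hx hx' =>
    hnear x hx hx'.1.ne' ⟨hl.trans hx'.1, hx'.2⟩
  refine ⟨vr - vl, fun a b hab hS => ?_⟩
  by_cases hmem : s ∈ Set.Ioo a b
  · obtain ⟨u1, v1, h1⟩ := h a s hmem.1 fun x hx hx' =>
      hS x (Finset.mem_erase.2 ⟨hx'.2.ne, hx⟩) ⟨hx'.1, hx'.2.trans hmem.2⟩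
    obtain ⟨u2, v2, h2⟩ := h s b hmem.2 fun x hx hx' =>
      hS x (Finset.mem_erase.2 ⟨hx'.1.ne', hx⟩) ⟨hmem.1.trans hx'.1, hx'.2⟩
    obtain ⟨-, rfl⟩ := eq_of_affine_eqOn_Ioo (max_lt hmem.1 hl) (u := u1) (u' := ul) (v' := vl)
      fun t ht => by
        rw [← h1 t ⟨(le_max_left _ _).trans_lt ht.1, ht.2⟩,
          huvl t ⟨(le_max_right _ _).trans_lt ht.1, ht.2⟩]
    obtain ⟨-, rfl⟩ := eq_of_affine_eqOn_Ioo (lt_min hmem.2 hr) (u := u2) (u' := ur) (v' := vr)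
      fun t ht => by
        rw [← h2 t ⟨ht.1, ht.2.trans_le (min_le_left _ _)⟩,
          huvr t ⟨ht.1, ht.2.trans_le (min_le_right _ _)⟩]
    have e1 : f s = u1 + s • v1 := by
      have hc : IsClosed {t | f t = u1 + t • v1} := isClosed_eq hf (by fun_prop)
      refine hc.closure_subset_iff.2 (fun t ht => h1 t ht) ?_
      rw [closure_Ioo hmem.1.ne]
      exact ⟨hmem.1.le, le_rfl⟩
    have e2 : f s = u2 + s • v2 := by
      have hc : IsClosed {t | f t = u2 + t • v2} := isClosed_eq hf (by fun_prop)
      refine hc.closure_subset_iff.2 (fun t ht => h2 t ht) ?_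
      rw [closure_Ioo hmem.2.ne]
      exact ⟨le_rfl, hmem.2.le⟩
    refine ⟨u1, v1, fun t ht => ?_⟩
    rcases lt_trichotomy t s with hts | rfl | hts
    · rw [h1 t ⟨ht.1, hts⟩, max_eq_right (by linarith), zero_smul, sub_zero]
    · rw [e1, sub_self, max_self, zero_smul, sub_zero]
    · rw [h2 t ⟨hts, ht.2⟩, max_eq_left (by linarith)]
      have e3 : u2 = u1 + s • v1 - s • v2 := by rw [← e1, e2, add_sub_cancel_right]
      rw [e3]
      module
  · obtain ⟨u, v, huv⟩ := h a b hab fun x hx => by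
      by_cases hxs : x = s
      · rwa [hxs]
      · exact hS x (Finset.mem_erase.2 ⟨hxs, hx⟩)
    by_cases hsa : s ≤ a
    · refine ⟨u + s • (vr - vl), v - (vr - vl), fun t ht => ?_⟩
      rw [huv t ht, max_eq_left (by linarith [ht.1])]
      module
    · have hbs : b ≤ s := by
        by_contra! hcon
        exact hmem ⟨not_le.1 hsa, hcon⟩
      refine ⟨u, v, fun t ht => ?_⟩
      rw [huv t ht, max_eq_right (by linarith [ht.2]), zero_smul, sub_zero]

/-- A continuous piecewise linear curve with at most `m` breakpoints is an affine map plus `m`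
rectified terms. -/
theorem IsCPwLWith.exists_relu_sum {p m : ℕ} {f : ℝ → Fin p → ℝ} (hf : IsCPwLWith m f) :
    ∃ (u v : Fin p → ℝ) (s : Fin m → ℝ) (c : Fin m → Fin p → ℝ),
      ∀ t, f t = u + t • v + ∑ i, max (t - s i) 0 • c i := by
  induction m generalizing f with
  | zero =>
    obtain ⟨-, S, hS, h⟩ := hf
    obtain rfl : S = ∅ := by simpa using hS
    obtain ⟨u, v, huv⟩ := exists_affine_of_forall_Ioo fun a b hab => h a b hab (by simp)
    exact ⟨u, v, 0, 0, fun t => by simp [huv]⟩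
  | succ m ih =>
    obtain ⟨hc, S, hS, h⟩ := hf
    rcases S.eq_empty_or_nonempty with rfl | ⟨s, hs⟩
    · obtain ⟨u, v, huv⟩ := exists_affine_of_forall_Ioo fun a b hab => h a b hab (by simp)
      exact ⟨u, v, 0, 0, fun t => by simp [huv]⟩
    · obtain ⟨c, hc'⟩ := exists_sub_relu hc hs h
      obtain ⟨u, v, s', c', h'⟩ := ih (f := fun t => f t - max (t - s) 0 • c)
        ⟨by fun_prop, S.erase s, by rw [Finset.card_erase_of_mem hs]; omega, hc'⟩
      refine ⟨u, v, Fin.cons s s', Fin.cons c c', fun t => ?_⟩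
      rw [Fin.sum_univ_succ]
      simp only [Fin.cons_zero, Fin.cons_succ]
      rw [add_left_comm, ← h' t, add_sub_cancel]

/-- Piecewise linear curves with a bounded number of breakpoints are networks of bounded size. -/
theorem realizable_of_isCPwLWith {P : Type*} {p m : ℕ} {f : P → ℝ → Fin p → ℝ}
    (hf : ∀ x, IsCPwLWith m (f x)) (i : Fin p) :
    Realizable (fun _ => 1) (fun x t => f x t i) := by
  choose u v s c h using fun x => (hf x).exists_relu_sum
  have hid : Realizable (fun _ : P => 1) (fun _ (t : ℝ) => t) := Realizable.id
  have h1 := (Realizable.const (E := ℝ) (δ := fun _ : P => 1) fun x => u x i).add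
    (hid.const_mul fun x => v x i)
  have h2 := Realizable.sum (Finset.univ : Finset (Fin m)) fun k _ =>
    ((hid.sub (Realizable.const fun x => s x k)).max_zero fun _ => le_rfl).const_mul
      fun x => c x k i
  convert h1.add h2 using 3 with x t
  rw [h]
  simp [Finset.sum_apply, mul_comm]

/-- The hat function of height `1 / 2` with vertices `k`, `k + 1 / 2`, `k + 1`, times the vector
`e`. -/
noncomputable def testHat {p : ℕ} (k : ℕ) (e : Fin p → ℝ) (t : ℝ) : Fin p → ℝ :=
  zigzag 1 (t - k) • e

theorem zigzag_one (t : ℝ) : zigzag 1 t = max (min t (1 - t)) 0 := by simp [zigzag]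

theorem isCPwLWith_testHat {p : ℕ} (k : ℕ) (e : Fin p → ℝ) : IsCPwLWith 3 (testHat k e) := by
  unfold testHat
  simp only [zigzag_one]
  refine ⟨by fun_prop, ({(k : ℝ), (k : ℝ) + 1 / 2, (k : ℝ) + 1} : Finset ℝ), Finset.card_le_three,
    fun a b _ hS => ?_⟩
  have h0 := hS k (by simp)
  have h1 := hS (k + 1 / 2) (by simp)
  have h2 := hS (k + 1) (by simp)
  simp only [Set.mem_Ioo, not_and_or, not_lt] at h0 h1 h2
  rcases h0 with h0 | h0
  · rcases h1 with h1 | h1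
    · rcases h2 with h2 | h2
      · refine ⟨0, 0, fun t ht => ?_⟩
        beta_reduce
        rw [max_eq_right (min_le_of_right_le (by linarith [ht.1]))]
        simp
      · refine ⟨(1 + k : ℝ) • e, -e, fun t ht => ?_⟩
        beta_reduce
        rw [min_eq_right (by linarith [ht.1]), max_eq_left (by linarith [ht.2])]
        module
    · refine ⟨(-k : ℝ) • e, e, fun t ht => ?_⟩
      beta_reduce
      rw [min_eq_left (by linarith [ht.2]), max_eq_left (by linarith [ht.1])]
      module
  · refine ⟨0, 0, fun t ht => ?_⟩
    beta_reduce
    rw [max_eq_right (min_le_of_left_le (by linarith [ht.2]))]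
    simp

theorem SupportedIn.eq_zero {p L : ℕ} {f : ℝ → Fin p → ℝ} (hf : SupportedIn L f) {t : ℝ}
    (ht : t ∉ Set.Icc (0 : ℝ) L) : f t = 0 :=
  image_eq_zero_of_notMem_tsupport fun h => ht (hf h)

theorem SupportedIn.eq_zero_of_continuous {p L : ℕ} {f : ℝ → Fin p → ℝ} (hf : SupportedIn L f)
    (hc : Continuous f) {t : ℝ} (ht : t ∉ Set.Ioo (0 : ℝ) L) : f t = 0 := by
  have h1 : Function.support f ⊆ interior (Set.Icc (0 : ℝ) L) :=
    interior_maximal ((subset_tsupport f).trans hf)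
      (isOpen_ne_fun hc continuous_const)
  rw [interior_Icc] at h1
  by_contra h
  exact ht (h1 h)

theorem supportedIn_testHat {p L k : ℕ} (hk : k + 1 ≤ L) (e : Fin p → ℝ) :
    SupportedIn L (testHat k e) := by
  have hk' : (k : ℝ) + 1 ≤ L := by exact_mod_cast hk
  refine closure_minimal (fun t ht => ?_) isClosed_Icc
  by_contra h
  refine ht ?_
  have : zigzag 1 (t - k) = 0 := by
    by_cases h0 : 0 ≤ t
    · exact zigzag_of_ge (by
        push_cast
        linarith [lt_of_not_ge fun h' => h ⟨h0, h'⟩])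
    · exact zigzag_of_nonpos 1 (by linarith [(k.cast_nonneg : (0 : ℝ) ≤ k), not_le.1 h0])
  rw [testHat, this, zero_smul]

theorem zigzag_one_int_add_half (j : ℤ) : zigzag 1 (j + 1 / 2) = if j = 0 then 1 / 2 else 0 := by
  split_ifs with h
  · rw [h, zigzag_one]; norm_num
  · rcases lt_or_gt_of_ne h with h | h
    · have : (j : ℝ) ≤ -1 := by exact_mod_cast (by omega : j ≤ -1)
      exact zigzag_of_nonpos 1 (by linarith)
    · have : (1 : ℝ) ≤ j := by exact_mod_cast h
      exact zigzag_of_ge (by push_cast; linarith)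

/-! ### The window and the linear part -/

/-- An operator that preserves the window `[0, L]` has no shifts outside `[0, (M - 1) L]`: hat
functions on the first and on the last unit interval of the window would be moved out of it. -/
theorem PreservesWindow.apply_eq_zero {M p r L : ℕ} (hM : 1 ≤ M) (hL : 1 ≤ L)
    {A : Fin r → Fin r → ℤ → Matrix (Fin p) (Fin p) ℝ} {B : Fin r → ℝ → Fin p → ℝ}
    (hB : ∀ a, SupportedIn L (B a)) (h : PreservesWindow M L A B) (a b : Fin r) (i i' : Fin p)
    {j : ℤ} (hj : j ∉ Finset.Icc (0 : ℤ) ((M - 1) * L)) : A a b j i i' = 0 := by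
  classical
  have hM0 : (0 : ℝ) < M := by exact_mod_cast hM
  have key : ∀ k : ℕ, k + 1 ≤ L → ((j : ℝ) + k + 1 / 2) / M ∉ Set.Icc (0 : ℝ) L →
      A a b j i i' = 0 := by
    intro k hk hout
    set t := ((j : ℝ) + k + 1 / 2) / M with ht
    have hMt : (M : ℝ) * t = j + k + 1 / 2 := by rw [ht]; field_simp
    have h1 := h (Pi.single b (testHat k (Pi.single i' 1))) (fun b' => by
      by_cases hb : b' = b
      · subst hb
        rw [Pi.single_eq_same]
        exact ⟨⟨3, isCPwLWith_testHat k _⟩, supportedIn_testHat hk _⟩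
      · rw [Pi.single_eq_of_ne hb]
        exact ⟨⟨0, isCPwLWith_zero 0⟩, by simp [SupportedIn, tsupport]⟩) a
    have h2 := h1.eq_zero hout
    have hsum : ∀ j' : ℤ, ∑ b', A a b' j' *ᵥ
        (Pi.single b (testHat k (Pi.single i' 1)) : Fin r → ℝ → Fin p → ℝ) b' (M * t - j') =
        (if j - j' = 0 then (1 / 2 : ℝ) else 0) • A a b j' *ᵥ Pi.single i' 1 := by
      intro j'
      rw [Finset.sum_eq_single b]
      · rw [Pi.single_eq_same, testHat, ← zigzag_one_int_add_half, Matrix.mulVec_smul, hMt]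
        congr 2
        push_cast
        ring
      · intro b' _ hb
        rw [Pi.single_eq_of_ne hb, Pi.zero_apply, Matrix.mulVec_zero]
      · intro hb
        exact absurd (Finset.mem_univ b) hb
    rw [refineOp, (hB a).eq_zero hout, add_zero, finsum_congr hsum, finsum_eq_single _ j] at h2
    · simpa using congrFun h2 i
    · intro j' hj'
      rw [if_neg (by omega), zero_smul]
  rw [Finset.mem_Icc, not_and_or, not_le, not_le] at hj
  rcases hj with hj | hj
  · refine key 0 hL fun hmem => ?_
    have : (j : ℝ) ≤ -1 := by exact_mod_cast (by omega : j ≤ -1)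
    have h3 := mul_nonneg hmem.1 hM0.le
    rw [div_mul_cancel₀ _ hM0.ne'] at h3
    push_cast at h3
    linarith
  · refine key (L - 1) (by omega) fun hmem => ?_
    have h3 : ((M - 1 : ℝ)) * L + 1 ≤ j := by exact_mod_cast hj
    have h4 := (div_le_iff₀ hM0).1 hmem.2
    rw [Nat.cast_sub hL] at h4
    push_cast at h4
    linarith

/-- The scalar coordinate functions of a family of curves. -/
def coords {p r : ℕ} (Γ : Fin r → ℝ → Fin p → ℝ) : Fin r × Fin p → ℝ → ℝ := fun x t => Γ x.1 t x.2

/-- The coefficients of the refinement operator in coordinates. -/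
def coordMatrix {p r : ℕ} (A : Fin r → Fin r → ℤ → Matrix (Fin p) (Fin p) ℝ) :
    Fin r × Fin p → Fin r × Fin p → ℤ → ℝ := fun x y j => A x.1 y.1 j x.2 y.2

section Refinement

variable {M p r L : ℕ} {A : Fin r → Fin r → ℤ → Matrix (Fin p) (Fin p) ℝ}
  {B Γ : Fin r → ℝ → Fin p → ℝ}

theorem coords_refineOp
    (hA : ∀ x y, ∀ j ∉ Finset.Icc (0 : ℤ) ((M - 1) * L), coordMatrix A x y j = 0) :
    coords (refineOp M A B Γ) = refineLin M L (coordMatrix A) (coords Γ) + coords B := by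
  ext ⟨a, i⟩ t
  rw [Pi.add_apply, Pi.add_apply, refineLin_apply]
  simp only [coords, refineOp, Pi.add_apply]
  rw [finsum_eq_sum_of_support_subset (s := Finset.Icc (0 : ℤ) ((M - 1) * L))]
  · simp only [Finset.sum_apply, Fintype.sum_prod_type, Matrix.mulVec, dotProduct, coordMatrix]
  · intro j hj
    by_contra h
    refine hj (Finset.sum_eq_zero fun b _ => ?_)
    have : A a b j = 0 := by
      ext k l
      exact hA (a, k) (b, l) j h
    rw [this, Matrix.zero_mulVec]

/-- The iterates of the affine operator: the forcing terms enter through the iterates of the linear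
part. -/
theorem coords_iterate_refineOp
    (hA : ∀ x y, ∀ j ∉ Finset.Icc (0 : ℤ) ((M - 1) * L), coordMatrix A x y j = 0) (n : ℕ) :
    coords ((refineOp M A B)^[n] Γ) = (refineLin M L (coordMatrix A) ^ n) (coords Γ) +
      ∑ k ∈ Finset.range n, (refineLin M L (coordMatrix A) ^ k) (coords B) := by
  induction n with
  | zero => simp
  | succ n ih =>
    rw [Function.iterate_succ_apply', coords_refineOp hA, ih, map_add, map_sum, pow_succ',
      Module.End.mul_apply, Finset.sum_range_succ']
    simp only [pow_succ', Module.End.mul_apply, pow_zero, Module.End.one_apply, add_assoc]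

variable (M p r L) in
/-- Linear depth for the iterates of the linear part, with network sizes that depend only on the
dimensions, the window and the number of breakpoints of the initial curves. -/
theorem exists_net_refineLin_pow (hM : 1 ≤ M) (hL : 1 ≤ L) (m : ℕ) :
    ∃ W C : ℕ, ∀ A : Fin r × Fin p → Fin r × Fin p → ℤ → ℝ,
      (∀ x y, ∀ j ∉ Finset.Icc (0 : ℤ) ((M - 1) * L), A x y j = 0) →
      ∀ Γ : Fin r → ℝ → Fin p → ℝ, (∀ a, IsCPwLWith m (Γ a) ∧ SupportedIn L (Γ a)) →
      ∀ n : ℕ, Net W (C * (n + 1)) ℝ (fun t x => (refineLin M L A ^ n) (coords Γ) x t) := by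
  let P := {z : (Fin r × Fin p → Fin r × Fin p → ℤ → ℝ) × (Fin r → ℝ → Fin p → ℝ) × ℕ //
    (∀ x y, ∀ j ∉ Finset.Icc (0 : ℤ) ((M - 1) * L), z.1 x y j = 0) ∧
      ∀ a, IsCPwLWith m (z.2.1 a) ∧ SupportedIn L (z.2.1 a)}
  have hc : ∀ (z : P) a, Continuous (z.1.2.1 a) := fun z a => (z.2.2 a).1.1
  obtain ⟨W, C, h⟩ := realizable_refineLin_pow (P := P) (M := M) hM hL (fun z => z.1.2.2)
    (A := fun z => z.1.1) (fun z => z.2.1) (g := fun z => coords z.1.2.1)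
    (fun x => realizable_of_isCPwLWith (fun z : P => (z.2.2 x.1).1) x.2)
    (fun z x => (continuous_apply x.2).comp (hc z x.1))
    (fun z x t ht => congrFun ((z.2.2 x.1).2.eq_zero_of_continuous (hc z x.1) ht) x.2)
  exact ⟨W, C, fun A hA Γ hΓ n => h ⟨(A, Γ, n), hA, hΓ⟩⟩

/-- Components and linear readouts are linear images of the coordinate functions, hence cost no
additional layers. -/
theorem Net.realized {W D : ℕ} (h : Net W D ℝ (fun t x => coords Γ x t)) : Realized W D Γ := by
  have key : ∀ (q : ℕ) (R : (Fin r × Fin p → ℝ) →ₗ[ℝ] (Fin q → ℝ)),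
      CurveInUpsilon W D q (fun t => R (fun x => coords Γ x t)) := fun q R => by
    have := ((h.postcomp R 0).precomp (LinearMap.proj (R := ℝ) (φ := fun _ : Fin 1 => ℝ) 0) 0)
    simp only [add_zero] at this
    exact this.upsilon
  exact ⟨key _ (LinearMap.funLeft ℝ ℝ finProdFinEquiv.symm),
    fun a => key _ (LinearMap.funLeft ℝ ℝ fun i => (a, i)),
    fun q R => key q (R ∘ₗ LinearMap.funLeft ℝ ℝ finProdFinEquiv.symm)⟩

end Refinement

end ReLURefinement

theorem mainTheorem3 (M p r L mγ : ℕ) (hM : 2 ≤ M) (hp : 1 ≤ p) (hr : 1 ≤ r) (hL : 1 ≤ L) :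
    (∀ mB : ℕ, ∃ C₀ C₁ : ℕ, 0 < C₀ ∧ 0 < C₁ ∧
      ∀ (A : Fin r → Fin r → ℤ → Matrix (Fin p) (Fin p) ℝ) (B Γ : Fin r → ℝ → Fin p → ℝ),
        (∀ a b, {j : ℤ | A a b j ≠ 0}.Finite) →
        (∀ a, ReLURefinement.IsCPwLWith mγ (Γ a) ∧ ReLURefinement.SupportedIn L (Γ a)) →
        (∀ a, ReLURefinement.IsCPwLWith mB (B a) ∧ ReLURefinement.SupportedIn L (B a)) →
        ReLURefinement.PreservesWindow M L A B →
        ∀ n : ℕ, 1 ≤ n →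
          ReLURefinement.Realized C₀ (C₁ * n ^ 2) ((ReLURefinement.refineOp M A B)^[n] Γ)) ∧
    (∃ C₀ C₁ : ℕ, 0 < C₀ ∧ 0 < C₁ ∧
      ∀ (A : Fin r → Fin r → ℤ → Matrix (Fin p) (Fin p) ℝ) (B Γ : Fin r → ℝ → Fin p → ℝ),
        (∀ a b, {j : ℤ | A a b j ≠ 0}.Finite) →
        (∀ a, ReLURefinement.IsCPwLWith mγ (Γ a) ∧ ReLURefinement.SupportedIn L (Γ a)) →
        (∀ a t, B a t = 0) →
        ReLURefinement.PreservesWindow M L A B →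
        ∀ n : ℕ, 1 ≤ n →
          ReLURefinement.Realized C₀ (C₁ * n) ((ReLURefinement.refineOp M A B)^[n] Γ)) := by
  have hM1 : 1 ≤ M := by omega
  obtain ⟨W, C, hΓ⟩ := ReLURefinement.exists_net_refineLin_pow M p r L hM1 hL mγ
  set N := Module.finrank ℝ (Fin r × Fin p → ℝ) * 2
  refine ⟨fun mB => ?_, ?_⟩
  · obtain ⟨W', C', hB⟩ := ReLURefinement.exists_net_refineLin_pow M p r L hM1 hL mB
    set N' := Module.finrank ℝ (ℝ × (Fin r × Fin p → ℝ)) * 2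
    refine ⟨W + N + 1 + (W' + N + N' + N), 2 * C + C' + 1, by omega, by omega,
      fun A B Γ _ hΓ' hB' hwin n hn => ?_⟩
    have hA : ∀ x y, ∀ j ∉ Finset.Icc (0 : ℤ) ((M - 1) * L),
        ReLURefinement.coordMatrix A x y j = 0 := fun x y j hj =>
      hwin.apply_eq_zero hM1 hL (fun a => (hB' a).2) x.1 y.1 x.2 y.2 (j := j) hj
    have hn2 : n ≤ n ^ 2 := Nat.le_self_pow (by omega) n
    -- The iterate of `Γ` has linear depth; the `n` iterates of `B`, each of depth `C' * n`, are
    -- summed one after the other.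
    have h1 := ((hΓ _ hA Γ hΓ' n).mono (by omega : W ≤ W + N + 1)).mono_depth
      (D' := (2 * C + C' + 1) * n ^ 2) (by omega) (by nlinarith)
    have h2 := ReLURefinement.Net.sum_range n fun k hk =>
      ((hB _ hA B hB' k).mono (by omega : W' ≤ W' + N)).mono_depth
        (D' := C' * n) (by omega) (Nat.mul_le_mul_left _ hk)
    have h3 := (h2.mono (Nat.le_add_right _ N)).mono_depth
      (D' := (2 * C + C' + 1) * n ^ 2) (by omega) (by nlinarith)
    refine ReLURefinement.Net.realized ?_
    convert h1.add h3 using 2 with t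
    ext x
    rw [ReLURefinement.coords_iterate_refineOp hA]
    simp only [Pi.add_apply, Finset.sum_apply]
  · refine ⟨W + N + 1, 2 * C + 1, by omega, by omega, fun A B Γ _ hΓ' hB' hwin n hn => ?_⟩
    have hB0 : B = 0 := by
      ext a t i
      rw [hB' a t]
      rfl
    have hA : ∀ x y, ∀ j ∉ Finset.Icc (0 : ℤ) ((M - 1) * L),
        ReLURefinement.coordMatrix A x y j = 0 := fun x y j hj =>
      hwin.apply_eq_zero hM1 hL (fun a => by
        simp [hB0, ReLURefinement.SupportedIn, tsupport]) x.1 y.1 x.2 y.2 (j := j) hj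
    have h1 := ((hΓ _ hA Γ hΓ' n).mono (by omega : W ≤ W + N + 1)).mono_depth
      (D' := (2 * C + 1) * n) (by omega) (by nlinarith)
    refine ReLURefinement.Net.realized ?_
    convert h1 using 2 with t
    ext x
    have hc : ReLURefinement.coords B = 0 := by
      rw [hB0]
      rfl
    rw [ReLURefinement.coords_iterate_refineOp hA, hc]
    simp only [map_zero, Finset.sum_const_zero, add_zero]
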